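/- Let $\sigma$ be surface measure on the unit sphere $S^2\subset\mathbb R^3$. For complex-valued $f\in L^2(S^2,\sigma)$ put $\widehat{f\sigma}(\xi)=\int_{S^2}e^{-ix\cdot\xi}f(x)\,d\sigma(x)$ for $\xi\in\mathbb R^3$, and let $\mathbf 1$ be the constant function $1$ on $S^2$. **Theorem 1.5.** There exists $\delta>0$ such that every complex-valued $f\in L^2(S^2,\sigma)$ with $\|f-\mathbf 1\|_{L^2(S^2,\sigma)}<\delta$ satisfies $$\frac{\|\widehat{f\sigma}\|_{L^4(\mathbb R^3)}^4}{\|f\|_{L^2(S^2,\sigma)}^4}\le\frac{\|\widehat{\sigma}\|_{L^4(\mathbb R^3)}^4}{\|\mathbf 1\|_{L^2(S^2,\sigma)}^4}$$ (the left side being read as $0$ if $f=0$ almost everywhere). If equality holds, then $|f|$ is constant $\sigma$-almost everywhere; if equality holds and $f$ is real-valued, then $f$ itself is constant $\sigma$-almost everywhere. -/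

import Mathlib

open MeasureTheory
open scoped ENNReal

noncomputable section

/-- Three-dimensional Euclidean space. -/
abbrev R3 : Type := EuclideanSpace ℝ (Fin 3)

/-- The unit sphere `S²` of `ℝ³`. -/
abbrev S2 : Type := Metric.sphere (0 : R3) 1

/-- Surface measure `σ` on `S²` (total mass `4π`): the spherical part of Lebesgue measure in
polar coordinates, `dx = r² dr dσ`. -/
def surfaceMeasure : Measure S2 := (volume : Measure R3).toSphere

/-- The Fourier transform of the complex measure `f σ`:
`(fσ)^(ξ) = ∫ e^{-i x·ξ} f(x) dσ(x)`. -/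
def fourierSphere (f : S2 → ℂ) (ξ : R3) : ℂ :=
  ∫ x : S2, Complex.exp (-Complex.I * ((inner ℝ (x : R3) ξ : ℝ) : ℂ)) * f x ∂surfaceMeasure

/-- The functional `‖(fσ)^‖₄⁴ / ‖f‖₂⁴`, with values in `[0, ∞]`. -/
def restrictionRatio (f : S2 → ℂ) : ℝ≥0∞ :=
  eLpNorm (fourierSphere f) 4 (volume : Measure R3) ^ 4 / eLpNorm f 2 surfaceMeasure ^ 4

end

/-!
The inequality holds for every `f ∈ L²`, and constants attain it; the smallness of `f - 1` serves
only to fix the sign of a real extremizer. The argument is Foschi's, with a Gaussian cutoff in place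
of the singular measure on `{x₁ + x₂ = x₃ + x₄}`.

*Regularization.* Plancherel's identity with a Gaussian cutoff (`integral_vecTransform_mul_conj`)
turns `∫ |(fσ)^|⁴ e^{-|ξ|²/(4π²c)}` into
`(2π)³ ∫ f(x₁) f(x₂) conj(f(x₃) f(x₄)) heat c (x₁ + x₂ - x₃ - x₄) dσ⁴`, where `heat c` is an
approximate identity as `c → ∞`. This is at most the same expression for `F = |f|`.

*The geometric identity.* For unit vectors with `d = x₁ + x₂ - x₃ - x₄`,
`|x₁+x₂|² + |x₃+x₄|² + |x₁-x₃|² + |x₂-x₄|² + |x₁-x₄|² + |x₂-x₃|² = 8 + |d|²`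
(`sum_norm_sq_pairs`). Inserting it as a weight and applying the arithmetic-geometric mean
inequality in each of the three pairings bounds the quadratic form by integrals of `F²(x) F²(y)`
(`quadForm_le`). The weights cancel the singularity of `σ * σ`, which has density `2π/|w|` on
`|w| < 2` (`map_add_prod_surfaceMeasure`, from `σ^ = 4π sin|ξ|/|ξ|` and uniqueness of
characteristic functions). In the limit `‖(fσ)^‖₄⁴ ≤ 2π⁴ 𝓔(|f|²)`
(`eLpNorm_fourierSphere_le`), with equality for `f = 1`, where
`𝓔(g) = 2 ∬ g(x) g(y) |x + y| + 4 ∬ g(x) g(y) |x - y|`.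

*The energy.* Since `|v|` is a positive superposition of the functions `1 - e^{-u²|v|²}`, and Gaussians
are positive definite, `𝓔` is negative definite on functions of mean zero; rotation invariance removes
the cross term with constants. So constants maximize `𝓔` at a given mean, and are the only
maximizers (`energy_le`). This gives the inequality, and constancy of `|f|` in case of equality.

*Real extremizers.* If `f = r s` with `s = ±1` and `E = {s = -1}`, equality forces
`∫ (1 - s₁ s₂ s₃ s₄) heat c (d) → 0`. The quadruples with `x₁ ∈ E` and no other entry in `E` already
contribute a fixed multiple of `|E|`, up to the quadruples with two given entries in `E`, whose mass
is `o(|E|)` as `|E| → 0` because the density `2π/|w|` is square integrable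
(`quadForm_signOf_le`). So `|E|` is `0` as soon as it is small.
-/

open Set Real Filter Topology

/-! ### Polar coordinates and the Fourier transform of surface measure along a ray -/

lemma finrank_R3 : Module.finrank ℝ R3 = 3 := by simp

instance : IsFiniteMeasure surfaceMeasure := by unfold surfaceMeasure; infer_instance

/-- Integration in polar coordinates in `ℝ³`. -/
lemma integral_eq_integral_polar {F : R3 → ℂ} (hF : Integrable F) :
    ∫ x, F x = ∫ r in Ioi (0 : ℝ), (r ^ 2) • ∫ ω : S2, F (r • (ω : R3)) ∂surfaceMeasure := by
  have hmp := (volume : Measure R3).measurePreserving_homeomorphUnitSphereProd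
  have hemb := (homeomorphUnitSphereProd R3).measurableEmbedding
  have hsub : Integrable (fun p : S2 × Ioi (0 : ℝ) => F (p.2.1 • (p.1 : R3)))
      ((volume : Measure R3).toSphere.prod (Measure.volumeIoiPow (Module.finrank ℝ R3 - 1))) := by
    rw [← hmp.integrable_comp_emb hemb]
    have : Integrable (fun x : ({0}ᶜ : Set R3) => F x.1) (volume.comap (Subtype.val : ({0}ᶜ : Set R3) → R3)) := by
      have := (integrableOn_iff_comap_subtypeVal (μ := volume) (f := F)
        (s := ({0}ᶜ : Set R3)) (measurableSet_singleton _).compl).1 hF.integrableOn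
      exact this
    refine this.congr (Filter.Eventually.of_forall fun x : ({0}ᶜ : Set R3) => ?_)
    have hx : ‖(x : R3)‖ ≠ 0 := norm_ne_zero_iff.2 x.2
    simp [smul_smul, hx]
  calc
    ∫ x, F x = ∫ x : ({0}ᶜ : Set R3), F x.1 ∂(volume.comap (Subtype.val : ({0}ᶜ : Set R3) → R3)) := by
      rw [integral_subtype_comap (measurableSet_singleton _).compl F,
        restrict_compl_singleton]
    _ = ∫ p : S2 × Ioi (0 : ℝ), F (p.2.1 • (p.1 : R3))
          ∂((volume : Measure R3).toSphere.prod
            (Measure.volumeIoiPow (Module.finrank ℝ R3 - 1))) := by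
      rw [← hmp.integral_comp hemb]
      refine integral_congr_ae (Filter.Eventually.of_forall fun x : ({0}ᶜ : Set R3) => ?_)
      have hx : ‖(x : R3)‖ ≠ 0 := norm_ne_zero_iff.2 x.2
      simp [smul_smul, hx]
    _ = ∫ r : Ioi (0 : ℝ), ∫ ω : S2, F (r.1 • (ω : R3)) ∂surfaceMeasure
          ∂(Measure.volumeIoiPow (Module.finrank ℝ R3 - 1)) := by
      rw [integral_prod_symm _ hsub]; rfl
    _ = _ := by
      rw [finrank_R3]
      simp only [Measure.volumeIoiPow, ENNReal.ofReal]
      rw [integral_withDensity_eq_integral_smul,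
        integral_subtype_comap measurableSet_Ioi fun a ↦ Real.toNNReal (a ^ (3 - 1)) •
          ∫ ω : S2, F (a • (ω : R3)) ∂surfaceMeasure,
        setIntegral_congr_fun measurableSet_Ioi fun x hx ↦ ?_]
      · rw [NNReal.smul_def, Real.coe_toNNReal _ (pow_nonneg hx.out.le _)]
      · exact (measurable_subtype_coe.pow_const _).real_toNNReal

/-- The surface measure of the sphere, seen as a measure on `ℝ³`. -/
noncomputable def sphereMeasure : Measure R3 := surfaceMeasure.map Subtype.val

instance : IsFiniteMeasure sphereMeasure := by unfold sphereMeasure; infer_instance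

lemma integral_sphereMeasure {E : Type*} [NormedAddCommGroup E] [NormedSpace ℝ E]
    (F : R3 → E) : ∫ x, F x ∂sphereMeasure = ∫ x : S2, F x ∂surfaceMeasure := by
  unfold sphereMeasure
  exact (MeasurableEmbedding.subtype_coe Metric.isClosed_sphere.measurableSet).integral_map F

/-- The slice of the ball of radius `ρ` at height `t` is a disc of area `π (ρ² - t²)`, or empty. -/
lemma volume_disc {ρ : ℝ} (t : ℝ) :
    (volume : Measure (Fin 2 → ℝ)).real {y | t ^ 2 + (y 0 ^ 2 + y 1 ^ 2) < ρ ^ 2} =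
      if |t| < |ρ| then π * (ρ ^ 2 - t ^ 2) else 0 := by
  split_ifs with h
  · have h' : 0 < ρ ^ 2 - t ^ 2 := by have := sq_lt_sq.2 h; linarith
    have : {y : Fin 2 → ℝ | t ^ 2 + (y 0 ^ 2 + y 1 ^ 2) < ρ ^ 2} =
        (WithLp.toLp 2) ⁻¹' (Metric.ball (0 : EuclideanSpace ℝ (Fin 2)) √(ρ ^ 2 - t ^ 2)) := by
      ext y
      simp only [mem_preimage, mem_ball_zero_iff, EuclideanSpace.norm_eq, mem_ofPred_eq,
        Fin.sum_univ_two, Real.norm_eq_abs, sq_abs]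
      rw [Real.sqrt_lt_sqrt_iff (by positivity)]
      constructor <;> intro h <;> linarith
    rw [this, measureReal_def,
      (PiLp.volume_preserving_toLp (Fin 2)).measure_preimage
        measurableSet_ball.nullMeasurableSet, InnerProductSpace.volume_ball]
    simp [Real.sq_sqrt h'.le]
    rw [Real.sq_sqrt pi_pos.le, show (1 : ℝ) + 1 = 2 by norm_num, Real.Gamma_two, div_one,
      ENNReal.toReal_ofReal pi_pos.le]
    ring
  · have : {y : Fin 2 → ℝ | t ^ 2 + (y 0 ^ 2 + y 1 ^ 2) < ρ ^ 2} = ∅ := by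
      ext y
      simp only [mem_ofPred_eq, mem_empty_iff_false, iff_false, not_lt]
      have := sq_le_sq.2 (not_lt.1 h)
      nlinarith [sq_nonneg (y 0), sq_nonneg (y 1)]
    simp [this]

/-- The integral of `exp (i x₀)` over a ball, computed by slices orthogonal to the first axis. -/
lemma setIntegral_ball_cexp_coord {R : ℝ} (hR : 0 < R) :
    ∫ x : R3 in Metric.ball 0 R, Complex.exp (x 0 * Complex.I) =
      ((4 * π * (sin R - R * cos R) : ℝ) : ℂ) := by
  have hslice : ∫ x : R3 in Metric.ball 0 R, Complex.exp (x 0 * Complex.I) =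
      ∫ t : ℝ, (if |t| < R then π * (R ^ 2 - t ^ 2) else 0 : ℝ) • Complex.exp (t * Complex.I) := by
    rw [← integral_indicator measurableSet_ball]
    have h1 := (PiLp.volume_preserving_toLp (Fin 3)).integral_comp
      (MeasurableEquiv.toLp 2 _).measurableEmbedding
      ((Metric.ball (0 : R3) R).indicator fun x => Complex.exp (x 0 * Complex.I))
    rw [← h1]
    have h2 := ((volume_preserving_piFinSuccAbove (fun _ : Fin 3 => ℝ) 0).symm).integral_comp
      (MeasurableEquiv.measurableEmbedding _) (fun y : Fin 3 → ℝ =>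
        ((Metric.ball (0 : R3) R).indicator fun x => Complex.exp (x 0 * Complex.I))
          (WithLp.toLp 2 y))
    rw [← h2]
    have hset : MeasurableSet {p : ℝ × (Fin 2 → ℝ) | p.1 ^ 2 + (p.2 0 ^ 2 + p.2 1 ^ 2) < R ^ 2} :=
      measurableSet_lt (by fun_prop) (by fun_prop)
    have h3 : ∀ p : ℝ × (Fin 2 → ℝ), ((Metric.ball (0 : R3) R).indicator
        fun x => Complex.exp (x 0 * Complex.I)) (WithLp.toLp 2
          ((MeasurableEquiv.piFinSuccAbove (fun _ : Fin 3 => ℝ) 0).symm p)) =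
        {p : ℝ × (Fin 2 → ℝ) | p.1 ^ 2 + (p.2 0 ^ 2 + p.2 1 ^ 2) < R ^ 2}.indicator
          (fun p => Complex.exp (p.1 * Complex.I)) p := by
      intro p
      have hmem : WithLp.toLp 2 ((MeasurableEquiv.piFinSuccAbove (fun _ : Fin 3 => ℝ) 0).symm p) ∈
          Metric.ball (0 : R3) R ↔
          p ∈ {p : ℝ × (Fin 2 → ℝ) | p.1 ^ 2 + (p.2 0 ^ 2 + p.2 1 ^ 2) < R ^ 2} := by
        rw [mem_ball_zero_iff, EuclideanSpace.norm_eq, Real.sqrt_lt' hR]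
        simp [Fin.sum_univ_succ, MeasurableEquiv.piFinSuccAbove_symm_apply, Fin.insertNthEquiv]
      by_cases hp : p ∈ {p : ℝ × (Fin 2 → ℝ) | p.1 ^ 2 + (p.2 0 ^ 2 + p.2 1 ^ 2) < R ^ 2}
      · rw [indicator_of_mem hp, indicator_of_mem (hmem.2 hp)]
        simp [MeasurableEquiv.piFinSuccAbove_symm_apply, Fin.insertNthEquiv]
      · rw [indicator_of_notMem hp, indicator_of_notMem (fun h => hp (hmem.1 h))]
    have hint : Integrable ({p : ℝ × (Fin 2 → ℝ) | p.1 ^ 2 + (p.2 0 ^ 2 + p.2 1 ^ 2) <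
        R ^ 2}.indicator (fun p => Complex.exp (p.1 * Complex.I))) := by
      rw [integrable_indicator_iff hset]
      refine Measure.integrableOn_of_bounded (M := 1) ?_ (by fun_prop)
        (Filter.Eventually.of_forall fun p => by simp [Complex.norm_exp])
      refine ne_of_lt (lt_of_le_of_lt (measure_mono (t := Metric.ball 0 (R + 1)) ?_)
        measure_ball_lt_top)
      intro p hp
      have hp' : p.1 ^ 2 + (p.2 0 ^ 2 + p.2 1 ^ 2) < R ^ 2 := hp
      rw [mem_ball_zero_iff, Prod.norm_def, max_lt_iff, pi_norm_lt_iff (by positivity)]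
      have hlt : ∀ a : ℝ, a ^ 2 < R ^ 2 → ‖a‖ < R + 1 := fun a ha => by
        have := sq_lt_sq.1 ha
        rw [abs_of_pos hR] at this
        rw [Real.norm_eq_abs]; linarith
      refine ⟨hlt _ ?_, fun i => hlt _ ?_⟩
      · nlinarith [sq_nonneg (p.2 0), sq_nonneg (p.2 1)]
      · fin_cases i <;> simp <;> nlinarith [sq_nonneg (p.2 0), sq_nonneg (p.2 1), sq_nonneg p.1]
    simp_rw [h3]
    rw [Measure.volume_eq_prod, integral_prod _ hint]
    refine integral_congr_ae (Filter.Eventually.of_forall fun t => ?_)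
    have := volume_disc (ρ := R) t
    rw [abs_of_pos hR] at this
    simp only
    rw [← this]
    have hsec : (fun y : Fin 2 → ℝ => {p : ℝ × (Fin 2 → ℝ) | p.1 ^ 2 + (p.2 0 ^ 2 + p.2 1 ^ 2) <
        R ^ 2}.indicator (fun p => Complex.exp (p.1 * Complex.I)) (t, y)) =
        {y : Fin 2 → ℝ | t ^ 2 + (y 0 ^ 2 + y 1 ^ 2) < R ^ 2}.indicator
          fun _ => Complex.exp (t * Complex.I) := by
      ext y; simp [indicator]
    rw [hsec, integral_indicator (measurableSet_lt (by fun_prop) (by fun_prop)),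
      setIntegral_const]
  have hoff : ∀ t : ℝ, (if |t| < R then π * (R ^ 2 - t ^ 2) else 0 : ℝ) •
      Complex.exp (t * Complex.I) = (Ioc (-R) R).indicator
        (fun t => ((π * (R ^ 2 - t ^ 2) : ℝ) : ℂ) * Complex.exp (t * Complex.I)) t := by
    intro t
    by_cases ht : |t| < R
    · rw [if_pos ht, indicator_of_mem (mem_Ioc.2 ⟨(abs_lt.1 ht).1, (abs_lt.1 ht).2.le⟩), Complex.real_smul]
    · rw [if_neg ht, zero_smul]
      by_cases h : t ∈ Ioc (-R) R
      · have : t = R := by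
          rcases h with ⟨h1, h2⟩
          by_contra hne
          exact ht (abs_lt.2 ⟨h1, lt_of_le_of_ne h2 hne⟩)
        rw [this] at h ⊢
        rw [indicator_of_mem h]; simp
      · rw [indicator_of_notMem h]
  rw [hslice]
  simp_rw [hoff]
  rw [integral_indicator measurableSet_Ioc, ← intervalIntegral.integral_of_le (by linarith)]
  have hderiv : ∀ t ∈ uIcc (-R) R, HasDerivAt (fun t : ℝ => (π : ℂ) *
      (((R : ℂ) ^ 2 - (t : ℂ) ^ 2) * (-Complex.I * Complex.exp (t * Complex.I))
        - 2 * t * Complex.exp (t * Complex.I)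
        - 2 * Complex.I * Complex.exp (t * Complex.I)))
      (((π * (R ^ 2 - t ^ 2) : ℝ) : ℂ) * Complex.exp (t * Complex.I)) t := by
    intro t _
    have ht : HasDerivAt (fun t : ℝ => (t : ℂ)) 1 t := Complex.ofRealCLM.hasDerivAt
    have he : HasDerivAt (fun t : ℝ => Complex.exp (t * Complex.I))
        (Complex.exp (t * Complex.I) * (1 * Complex.I)) t := (ht.mul_const Complex.I).cexp
    have hq : HasDerivAt (fun t : ℝ => (R : ℂ) ^ 2 - (t : ℂ) ^ 2) (-(2 * t)) t := by
      simpa using (ht.pow 2).const_sub ((R : ℂ) ^ 2)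
    have := (((hq.mul (he.const_mul (-Complex.I))).sub ((ht.const_mul 2).mul he)).sub
      (he.const_mul (2 * Complex.I))).const_mul (π : ℂ)
    convert! this using 1
    push_cast
    linear_combination ((π : ℂ) * Complex.exp (t * Complex.I) * ((R : ℂ) ^ 2 - (t : ℂ) ^ 2) + 2 * (π : ℂ) * Complex.exp (t * Complex.I)) * (Complex.I_mul_I)
  rw [intervalIntegral.integral_eq_sub_of_hasDerivAt hderiv
    (Continuous.intervalIntegrable (by fun_prop) _ _)]
  rw [Complex.exp_mul_I, Complex.exp_mul_I]
  push_cast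
  rw [Complex.cos_neg, Complex.sin_neg]
  linear_combination (-4 * π * Complex.sin R) * Complex.I_mul_I

/-- A linear isometry carrying a given vector to the first coordinate axis. -/
lemma exists_isometry_coord (v : R3) : ∃ U : R3 ≃ₗᵢ[ℝ] R3, ∀ x, (U x) 0 * ‖v‖ = inner ℝ x v := by
  let w : R3 := EuclideanSpace.single 0 ‖v‖
  have hw : ‖v‖ = ‖w‖ := by simp [w]
  refine ⟨(ℝ ∙ (v - w))ᗮ.reflection, fun x => ?_⟩
  have h := LinearIsometryEquiv.inner_map_map ((ℝ ∙ (v - w))ᗮ.reflection) x v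
  rw [Submodule.reflection_sub hw] at h
  rw [← h]
  simp only [w, EuclideanSpace.inner_single_right]
  simp
  ring

lemma setIntegral_ball_cexp_inner {R : ℝ} (hR : 0 < R) {e : R3} (he : ‖e‖ = 1) :
    ∫ x : R3 in Metric.ball 0 R, Complex.exp ((inner ℝ x e : ℝ) * Complex.I) =
      ((4 * π * (sin R - R * cos R) : ℝ) : ℂ) := by
  obtain ⟨U, hU⟩ := exists_isometry_coord e
  rw [← setIntegral_ball_cexp_coord hR, ← U.measurePreserving.setIntegral_preimage_emb
    U.toHomeomorph.measurableEmbedding (fun x => Complex.exp (x 0 * Complex.I))]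
  have : U ⁻¹' Metric.ball 0 R = Metric.ball 0 R := by
    simp
  rw [this]
  simp_rw [← hU, he, mul_one]

lemma norm_S2 (ω : S2) : ‖(ω : R3)‖ = 1 := by simp

/-- The Fourier transform of surface measure along a ray, obtained by
differentiating the integral over a ball with respect to the radius. -/
lemma integral_sphere_cexp_inner {r : ℝ} (hr : 0 < r) {e : R3} (he : ‖e‖ = 1) :
    ∫ ω : S2, Complex.exp ((r * inner ℝ (ω : R3) e : ℝ) * Complex.I) ∂surfaceMeasure =
      ((4 * π * sin r / r : ℝ) : ℂ) := by
  set A : ℝ → ℂ := fun r =>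
    ∫ ω : S2, Complex.exp ((r * inner ℝ (ω : R3) e : ℝ) * Complex.I) ∂surfaceMeasure with hA
  have hAc : Continuous A := by
    have : Continuous (Function.uncurry fun (r : ℝ) (ω : S2) =>
      Complex.exp ((r * inner ℝ (ω : R3) e : ℝ) * Complex.I)) := by
      unfold Function.uncurry; fun_prop
    simpa [hA] using continuous_parametric_integral_of_continuous (μ := surfaceMeasure) this
      (isCompact_univ (X := S2))
  have hball : ∀ R : ℝ, 0 < R → ∫ s in (0 : ℝ)..R, (s ^ 2) • A s =
      ((4 * π * (sin R - R * cos R) : ℝ) : ℂ) := by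
    intro R hR
    rw [← setIntegral_ball_cexp_inner hR he, ← integral_indicator measurableSet_ball,
      integral_eq_integral_polar, intervalIntegral.integral_of_le hR.le,
      integral_Ioc_eq_integral_Ioo, ← Ioi_inter_Iio, ← setIntegral_indicator measurableSet_Iio]
    · refine setIntegral_congr_fun measurableSet_Ioi fun s hs => ?_
      have hs' : (0 : ℝ) < s := hs
      by_cases h : s < R
      · have : ∀ ω : S2, s • (ω : R3) ∈ Metric.ball (0 : R3) R := fun ω => by
          simpa [norm_smul, norm_S2, abs_of_pos hs'] using h
        simp [indicator, h, hA, this, real_inner_smul_left]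
      · have : ∀ ω : S2, s • (ω : R3) ∉ Metric.ball (0 : R3) R := fun ω => by
          simpa [norm_smul, norm_S2, abs_of_pos hs'] using h
        simp only [indicator_of_notMem (this _)]
        simp [indicator, h]
    · rw [integrable_indicator_iff measurableSet_ball]
      exact Measure.integrableOn_of_bounded (M := 1) measure_ball_lt_top.ne (by fun_prop)
        (Filter.Eventually.of_forall fun p => by simp [Complex.norm_exp])
  have hd1 : HasDerivAt (fun R : ℝ => ∫ s in (0 : ℝ)..R, (s ^ 2) • A s) ((r ^ 2) • A r) r := by
    have hc : Continuous fun s : ℝ => (s ^ 2) • A s := by fun_prop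
    exact intervalIntegral.integral_hasDerivAt_right (hc.intervalIntegrable _ _)
      (hc.stronglyMeasurableAtFilter _ _) hc.continuousAt
  have hd2 : HasDerivAt (fun R : ℝ => ((4 * π * (sin R - R * cos R) : ℝ) : ℂ))
      ((4 * π * (r * sin r) : ℝ) : ℂ) r := by
    have : HasDerivAt (fun R : ℝ => 4 * π * (sin R - R * cos R)) (4 * π * (r * sin r)) r := by
      have := (((hasDerivAt_sin r).sub ((hasDerivAt_id r).mul (hasDerivAt_cos r)))).const_mul
        (4 * π)
      convert! this using 1
      simp
    exact this.ofReal_comp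
  have heq : (fun R : ℝ => ∫ s in (0 : ℝ)..R, (s ^ 2) • A s) =ᶠ[nhds r]
      fun R : ℝ => ((4 * π * (sin R - R * cos R) : ℝ) : ℂ) := by
    filter_upwards [lt_mem_nhds hr] with R hR using hball R hR
  have := hd1.unique (hd2.congr_of_eventuallyEq heq)
  have hr' : (r : ℂ) ≠ 0 := by exact_mod_cast hr.ne'
  rw [Complex.real_smul] at this
  change A r = _
  push_cast at this ⊢
  field_simp
  apply mul_left_cancel₀ hr'
  linear_combination this

/-! ### The convolution of surface measure with itself -/

lemma surfaceMeasure_real_univ : surfaceMeasure.real univ = 4 * π := by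
  unfold surfaceMeasure
  rw [Measure.toSphere_real_apply_univ, finrank_R3, measureReal_def,
    EuclideanSpace.volume_ball_fin_three]
  simp
  rw [ENNReal.toReal_ofReal (by positivity)]
  ring

/-- The Fourier transform of surface measure on the sphere is `4π sin|ξ| / |ξ|`. -/
lemma integral_sphere_cexp (ξ : R3) :
    ∫ ω : S2, Complex.exp ((inner ℝ (ω : R3) ξ : ℝ) * Complex.I) ∂surfaceMeasure =
      ((4 * π * sinc ‖ξ‖ : ℝ) : ℂ) := by
  by_cases h : ξ = 0
  · simp [h, surfaceMeasure_real_univ]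
  · have hn : 0 < ‖ξ‖ := norm_pos_iff.2 h
    have := integral_sphere_cexp_inner hn (e := ‖ξ‖⁻¹ • ξ) (by simp [norm_smul, hn.ne'])
    rw [sinc_of_ne_zero hn.ne', ← mul_div_assoc, ← this]
    simp_rw [real_inner_smul_right, ← mul_assoc, mul_inv_cancel₀ hn.ne', one_mul]

/-- The density of `σ * σ`: `2π / |w|` on the ball of radius `2`. -/
noncomputable def convDensity (w : R3) : ℝ := if ‖w‖ < 2 then 2 * π / ‖w‖ else 0

lemma convDensity_nonneg (w : R3) : 0 ≤ convDensity w := by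
  unfold convDensity; split_ifs <;> positivity

@[fun_prop]
lemma measurable_convDensity : Measurable convDensity :=
  Measurable.ite (measurableSet_lt (by fun_prop) (by fun_prop)) (by fun_prop) (by fun_prop)

lemma integrable_convDensity_pow {n : ℕ} (hn : n ≤ 2) :
    Integrable (fun w => convDensity w ^ n * if ‖w‖ < 2 then 1 else 0) := by
  have := (integrable_fun_norm_addHaar (volume : Measure R3)
    (f := fun r : ℝ => if r < 2 then (2 * π / r) ^ n else 0)).2 ?_
  · refine this.congr (Filter.Eventually.of_forall fun w => ?_)
    by_cases h : ‖w‖ < 2 <;> simp [convDensity, h]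
  · rw [finrank_R3]
    have : IntegrableOn (fun r : ℝ => (2 * π) ^ n * r ^ (2 - n)) (Ioo 0 2) :=
      (Continuous.integrableOn_Icc (by fun_prop)).mono_set Ioo_subset_Icc_self
    rw [← integrable_indicator_iff measurableSet_Ioo] at this
    rw [← integrable_indicator_iff measurableSet_Ioi]
    refine this.congr (Filter.Eventually.of_forall fun r => ?_)
    by_cases h0 : 0 < r <;> by_cases h2 : r < 2 <;> simp [indicator, h0, h2]
    rw [div_pow, ← Nat.sub_add_cancel hn, pow_add]
    field_simp
    simp

lemma integrable_convDensity : Integrable convDensity := by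
  refine (integrable_convDensity_pow one_le_two).congr (Filter.Eventually.of_forall fun w => ?_)
  by_cases h : ‖w‖ < 2 <;> simp [convDensity, h]

lemma integrable_convDensity_sq : Integrable (fun w => convDensity w ^ 2) := by
  refine (integrable_convDensity_pow le_rfl).congr (Filter.Eventually.of_forall fun w => ?_)
  by_cases h : ‖w‖ < 2 <;> simp [convDensity, h]

lemma integral_convDensity_mul_cexp (ξ : R3) :
    ∫ w : R3, (convDensity w : ℂ) * Complex.exp ((inner ℝ w ξ : ℝ) * Complex.I) =
      ((4 * π * sinc ‖ξ‖ : ℝ) : ℂ) ^ 2 := by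
  have hint : Integrable (fun w : R3 => (convDensity w : ℂ) *
      Complex.exp ((inner ℝ w ξ : ℝ) * Complex.I)) := by
    refine integrable_convDensity.ofReal.mul_bdd (c := 1) (by fun_prop) ?_
    exact Filter.Eventually.of_forall fun p => by simp [Complex.norm_exp]
  rw [integral_eq_integral_polar hint]
  have h1 : ∀ r ∈ Ioi (0 : ℝ), (r ^ 2) • ∫ ω : S2, (convDensity (r • (ω : R3)) : ℂ) *
      Complex.exp ((inner ℝ (r • (ω : R3)) ξ : ℝ) * Complex.I) ∂surfaceMeasure =
      (Iio 2).indicator (fun r : ℝ => ((8 * π ^ 2 * (r * sinc (r * ‖ξ‖)) : ℝ) : ℂ)) r := by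
    intro r hr
    have hr' : (0 : ℝ) < r := hr
    have hk : ∀ ω : S2, convDensity (r • (ω : R3)) = if r < 2 then 2 * π / r else 0 := by
      intro ω; simp [convDensity, norm_smul, abs_of_pos hr']
    have := integral_sphere_cexp (r • ξ)
    simp_rw [hk, real_inner_smul_left]
    simp_rw [real_inner_smul_right] at this
    rw [integral_const_mul, this, norm_smul, Real.norm_eq_abs, abs_of_pos hr', Complex.real_smul]
    by_cases h : r < 2
    · rw [indicator_of_mem (show r ∈ Iio (2:ℝ) from h), if_pos h]
      have : (r : ℂ) ≠ 0 := by exact_mod_cast hr'.ne'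
      push_cast
      field_simp
      ring
    · rw [indicator_of_notMem (show r ∉ Iio (2:ℝ) from h), if_neg h]; simp
  rw [setIntegral_congr_fun measurableSet_Ioi h1, setIntegral_indicator measurableSet_Iio,
    Ioi_inter_Iio, ← integral_Ioc_eq_integral_Ioo,
    ← intervalIntegral.integral_of_le (by norm_num), intervalIntegral.integral_ofReal,
    intervalIntegral.integral_const_mul]
  norm_cast
  by_cases h : ξ = 0
  · simp [h]; ring
  have hs : ‖ξ‖ ≠ 0 := norm_ne_zero_iff.2 h
  have h2 : ∀ r : ℝ, r * sinc (r * ‖ξ‖) = ‖ξ‖⁻¹ * sin (r * ‖ξ‖) := by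
    intro r
    by_cases hr : r = 0
    · simp [hr]
    · rw [sinc_of_ne_zero (mul_ne_zero hr hs)]; field_simp
  simp_rw [h2]
  rw [intervalIntegral.integral_const_mul, intervalIntegral.integral_comp_mul_right _ hs,
    integral_sin, sinc_of_ne_zero hs]
  have := Real.cos_two_mul ‖ξ‖
  have h3 := Real.sin_sq_add_cos_sq ‖ξ‖
  simp only [zero_mul, Real.cos_zero, smul_eq_mul]
  rw [this]
  field_simp
  linear_combination (-16 : ℝ) * h3

/-- The law of `x + y` under `σ ⊗ σ` is `σ * σ`, with density `2π/|w|` on the ball of radius `2`: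
both measures have the same characteristic function. -/
lemma map_add_prod_surfaceMeasure :
    (surfaceMeasure.prod surfaceMeasure).map (fun p : S2 × S2 => (p.1 : R3) + p.2) =
      volume.withDensity fun w => ENNReal.ofReal (convDensity w) := by
  have := isFiniteMeasure_withDensity_ofReal integrable_convDensity.hasFiniteIntegral
  refine Measure.ext_of_charFun (funext fun ξ => ?_)
  rw [charFun_apply, charFun_apply, integral_map (by fun_prop) (by fun_prop),
    integral_withDensity_eq_integral_toReal_smul (by fun_prop) (by simp)]
  simp only [ENNReal.toReal_ofReal (convDensity_nonneg _), Complex.real_smul]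
  rw [integral_convDensity_mul_cexp, ← integral_sphere_cexp, sq, ← integral_prod_mul]
  simp_rw [inner_add_left, Complex.ofReal_add, add_mul, Complex.exp_add]

lemma map_sub_prod_surfaceMeasure :
    (surfaceMeasure.prod surfaceMeasure).map (fun p : S2 × S2 => (p.1 : R3) - p.2) =
      volume.withDensity fun w => ENNReal.ofReal (convDensity w) := by
  have := isFiniteMeasure_withDensity_ofReal integrable_convDensity.hasFiniteIntegral
  refine Measure.ext_of_charFun (funext fun ξ => ?_)
  rw [charFun_apply, charFun_apply, integral_map (by fun_prop) (by fun_prop),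
    integral_withDensity_eq_integral_toReal_smul (by fun_prop) (by simp)]
  simp only [ENNReal.toReal_ofReal (convDensity_nonneg _), Complex.real_smul]
  have h2 := integral_sphere_cexp (-ξ)
  rw [norm_neg] at h2
  rw [integral_convDensity_mul_cexp, sq]
  nth_rw 1 [← integral_sphere_cexp]
  rw [← h2, ← integral_prod_mul]
  simp_rw [inner_sub_left, inner_neg_right, sub_eq_add_neg, Complex.ofReal_add, add_mul,
    Complex.exp_add]

lemma integral_add_eq_integral_convDensity {F : R3 → ℝ} (hF : Measurable F) :
    ∫ p : S2 × S2, F (p.1 + p.2) ∂(surfaceMeasure.prod surfaceMeasure) =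
      ∫ w, convDensity w * F w := by
  have := integral_map (μ := surfaceMeasure.prod surfaceMeasure)
    (φ := fun p : S2 × S2 => (p.1 : R3) + p.2) (f := F) (by fun_prop)
    hF.aestronglyMeasurable
  rw [← this, map_add_prod_surfaceMeasure,
    integral_withDensity_eq_integral_toReal_smul (by fun_prop) (by simp)]
  simp only [ENNReal.toReal_ofReal (convDensity_nonneg _), smul_eq_mul]

lemma integral_sub_eq_integral_convDensity {F : R3 → ℝ} (hF : Measurable F) :
    ∫ p : S2 × S2, F (p.1 - p.2) ∂(surfaceMeasure.prod surfaceMeasure) =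
      ∫ w, convDensity w * F w := by
  have := integral_map (μ := surfaceMeasure.prod surfaceMeasure)
    (φ := fun p : S2 × S2 => (p.1 : R3) - p.2) (f := F) (by fun_prop)
    hF.aestronglyMeasurable
  rw [← this, map_sub_prod_surfaceMeasure,
    integral_withDensity_eq_integral_toReal_smul (by fun_prop) (by simp)]
  simp only [ENNReal.toReal_ofReal (convDensity_nonneg _), smul_eq_mul]

/-- Sums of two points of the sphere almost surely have norm less than `2`. -/
lemma ae_norm_add_lt_two :
    ∀ᵐ p : S2 × S2 ∂(surfaceMeasure.prod surfaceMeasure), ‖(p.1 : R3) + p.2‖ < 2 := by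
  have h : ∀ᵐ w ∂((surfaceMeasure.prod surfaceMeasure).map
      (fun p : S2 × S2 => (p.1 : R3) + p.2)), ‖w‖ < 2 := by
    rw [map_add_prod_surfaceMeasure, ae_withDensity_iff (by fun_prop)]
    refine Filter.Eventually.of_forall fun w hw => ?_
    by_contra h
    simp [convDensity, h] at hw
  exact ae_of_ae_map (by fun_prop) h

lemma ae_norm_sub_lt_two :
    ∀ᵐ p : S2 × S2 ∂(surfaceMeasure.prod surfaceMeasure), ‖(p.1 : R3) - p.2‖ < 2 := by
  have h : ∀ᵐ w ∂((surfaceMeasure.prod surfaceMeasure).map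
      (fun p : S2 × S2 => (p.1 : R3) - p.2)), ‖w‖ < 2 := by
    rw [map_sub_prod_surfaceMeasure, ae_withDensity_iff (by fun_prop)]
    refine Filter.Eventually.of_forall fun w hw => ?_
    by_contra h
    simp [convDensity, h] at hw
  exact ae_of_ae_map (by fun_prop) h

/-- Surface measure is invariant under linear isometries. -/
lemma integral_sphere_comp_isometry (U : R3 ≃ₗᵢ[ℝ] R3) {F : R3 → ℝ} (hF : Measurable F) :
    ∫ x : S2, F (U x) ∂surfaceMeasure = ∫ x : S2, F x ∂surfaceMeasure := by
  have h : sphereMeasure.map U = sphereMeasure := by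
    refine Measure.ext_of_charFun (funext fun ξ => ?_)
    rw [charFun_apply, charFun_apply, integral_map (by fun_prop) (by fun_prop),
      integral_sphereMeasure, integral_sphereMeasure, integral_sphere_cexp]
    have : ∀ x : R3, inner ℝ (U x) ξ = inner ℝ x (U.symm ξ) := fun x => by
      rw [← U.inner_map_map x (U.symm ξ), U.apply_symm_apply]
    simp_rw [this]
    rw [integral_sphere_cexp, LinearIsometryEquiv.norm_map]
  rw [← integral_sphereMeasure (fun x => F (U x)), ← integral_sphereMeasure F]
  nth_rw 2 [← h]
  rw [integral_map (by fun_prop) hF.aestronglyMeasurable]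

/-! ### Gaussian regularization of Plancherel's identity -/

/-- The Gaussian probability density on `ℝ³` of variance `(2π²c)⁻¹` in each direction; it
concentrates at the origin as `c → ∞`. -/
noncomputable def heat (c : ℝ) (v : R3) : ℝ := √(π * c) ^ 3 * exp (-π ^ 2 * c * ‖v‖ ^ 2)

/-- The Fourier multiplier dual to `heat c`. -/
noncomputable def heatMultiplier (c : ℝ) (ξ : R3) : ℝ := exp (-(4 * π ^ 2 * c)⁻¹ * ‖ξ‖ ^ 2)

lemma heat_nonneg (c : ℝ) (v : R3) : 0 ≤ heat c v := by unfold heat; positivity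

lemma heat_neg (c : ℝ) (v : R3) : heat c (-v) = heat c v := by simp [heat]

lemma heat_sub_comm (c : ℝ) (v w : R3) : heat c (v - w) = heat c (w - v) := by
  rw [← heat_neg, neg_sub]

@[fun_prop]
lemma continuous_heat (c : ℝ) : Continuous (heat c) := by unfold heat; fun_prop

lemma heat_le {c : ℝ} (hc : 0 < c) (v : R3) : heat c v ≤ √(π * c) ^ 3 := by
  unfold heat
  refine mul_le_of_le_one_right (by positivity) (exp_le_one_iff.2 ?_)
  have : 0 ≤ π ^ 2 * c * ‖v‖ ^ 2 := by positivity
  linarith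

lemma abs_heat_le {c : ℝ} (hc : 0 < c) (v : R3) : |heat c v| ≤ √(π * c) ^ 3 := by
  rw [abs_of_nonneg (heat_nonneg c v)]; exact heat_le hc v

lemma heatMultiplier_pos (c : ℝ) (ξ : R3) : 0 < heatMultiplier c ξ := exp_pos _

@[fun_prop]
lemma continuous_heatMultiplier (c : ℝ) : Continuous (heatMultiplier c) := by
  unfold heatMultiplier; fun_prop

lemma integrable_exp_neg_mul_sq_norm {b : ℝ} (hb : 0 < b) :
    Integrable fun v : R3 => exp (-b * ‖v‖ ^ 2) := by
  have := (GaussianFourier.integrable_cexp_neg_mul_sq_norm_add (V := R3) (b := b) (by simpa) 0 0).re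
  refine this.congr (Eventually.of_forall fun v => ?_)
  simp [← Complex.ofReal_neg, ← Complex.ofReal_pow, ← Complex.ofReal_mul, ← Complex.ofReal_exp]

lemma integrable_heat {c : ℝ} (hc : 0 < c) : Integrable (heat c) := by
  unfold heat
  have := (integrable_exp_neg_mul_sq_norm (b := π ^ 2 * c) (by positivity)).const_mul
    (√(π * c) ^ 3)
  simpa [neg_mul] using this

lemma integrable_heatMultiplier {c : ℝ} (hc : 0 < c) : Integrable (heatMultiplier c) :=
  integrable_exp_neg_mul_sq_norm (by positivity)

lemma integral_heatMultiplier_mul_cexp {c : ℝ} (hc : 0 < c) (v : R3) :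
    ∫ ξ : R3, Complex.exp (-Complex.I * ((inner ℝ v ξ : ℝ) : ℂ)) * (heatMultiplier c ξ : ℂ) =
      (((2 * π) ^ 3 * heat c v : ℝ) : ℂ) := by
  have h := GaussianFourier.integral_cexp_neg_mul_sq_norm_add (V := R3)
    (b := (((4 * π ^ 2 * c)⁻¹ : ℝ) : ℂ)) (by rw [Complex.ofReal_re]; positivity) (-Complex.I) v
  have h1 : ∀ ξ : R3, Complex.exp (-Complex.I * ((inner ℝ v ξ : ℝ) : ℂ)) *
      (heatMultiplier c ξ : ℂ) = Complex.exp (-(((4 * π ^ 2 * c)⁻¹ : ℝ) : ℂ) * ‖ξ‖ ^ 2 +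
        -Complex.I * ((inner ℝ v ξ : ℝ) : ℂ)) := by
    intro ξ
    rw [add_comm, Complex.exp_add]
    simp [heatMultiplier]
  simp_rw [h1]
  rw [h, finrank_R3]
  have h2 : ((π : ℂ) / (((4 * π ^ 2 * c)⁻¹ : ℝ) : ℂ)) ^ (((3 : ℕ) : ℂ) / 2) =
      (((2 * π) ^ 3 * √(π * c) ^ 3 : ℝ) : ℂ) := by
    have h3 : (π : ℂ) / (((4 * π ^ 2 * c)⁻¹ : ℝ) : ℂ) = (((2 * π * √(π * c)) ^ 2 : ℝ) : ℂ) := by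
      rw [← Complex.ofReal_div]
      congr 1
      rw [mul_pow, sq_sqrt (by positivity)]
      field_simp
      ring
    rw [h3, show (((3 : ℕ) : ℂ) / 2) = (((3 : ℝ) / 2 : ℝ) : ℂ) by push_cast; rfl,
      ← Complex.ofReal_cpow (by positivity)]
    congr 1
    rw [← rpow_natCast, ← rpow_mul (by positivity)]
    norm_num
    rw [← rpow_natCast]
    rw [← mul_pow]; norm_cast
  rw [h2]
  unfold heat
  have hc' : (c : ℂ) ≠ 0 := by exact_mod_cast hc.ne'
  have hpi : (π : ℂ) ≠ 0 := by exact_mod_cast pi_ne_zero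
  push_cast
  rw [mul_assoc]
  congr 3
  field_simp
  rw [Complex.I_sq]; ring

lemma integral_heat_eq_one {c : ℝ} (hc : 0 < c) : ∫ v, heat c v = 1 := by
  unfold heat
  have h := GaussianFourier.integral_rexp_neg_mul_sq_norm (V := R3) (b := π ^ 2 * c)
    (by positivity)
  simp_rw [neg_mul] at h ⊢
  rw [integral_const_mul, h, finrank_R3]
  have h1 : π / (π ^ 2 * c) = (√(π * c))⁻¹ ^ 2 := by
    rw [inv_pow, sq_sqrt (by positivity)]; field_simp
  rw [h1, ← rpow_natCast, ← rpow_natCast, ← rpow_mul (by positivity)]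
  norm_num
  exact mul_inv_cancel₀ (by positivity)

lemma integral_heat_sub {c : ℝ} (hc : 0 < c) (v : R3) : ∫ w, heat c (v - w) = 1 := by
  rw [integral_sub_left_eq_self (heat c) volume v, integral_heat_eq_one hc]

lemma integrable_heat_sub {c : ℝ} (hc : 0 < c) (v : R3) : Integrable fun w => heat c (v - w) :=
  (integrable_heat hc).comp_sub_left v

/-- `heat c` is an approximate identity as `c → ∞`. -/
lemma tendsto_integral_heat_mul {f : R3 → ℝ} (hf : Integrable f) {v : R3}
    (hv : ContinuousAt f v) :
    Tendsto (fun c : ℝ => ∫ w, heat c (v - w) * f w) atTop (𝓝 (f v)) := by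
  have h := Real.tendsto_integral_gaussian_smul' (f := fun w => (f w : ℂ)) hf.ofReal (v := v)
    (Complex.continuous_ofReal.continuousAt.comp hv)
  have h2 : Tendsto (fun c : ℝ => ((∫ w, heat c (v - w) * f w : ℝ) : ℂ)) atTop (𝓝 (f v : ℂ)) := by
    refine h.congr' ?_
    filter_upwards [eventually_gt_atTop 0] with c hc
    rw [← integral_complex_ofReal]
    refine integral_congr_ae (Eventually.of_forall fun w => ?_)
    have h3 : ((π : ℂ) * c) ^ ((Module.finrank ℝ R3 : ℂ) / 2) = ((√(π * c) ^ 3 : ℝ) : ℂ) := by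
      rw [finrank_R3, ← Complex.ofReal_mul, show (((3 : ℕ) : ℂ) / 2) = (((3 : ℝ) / 2 : ℝ) : ℂ) by
        push_cast; rfl, ← Complex.ofReal_cpow (by positivity)]
      congr 1
      nth_rw 1 [← sq_sqrt (show 0 ≤ π * c by positivity)]
      rw [← rpow_natCast, ← rpow_mul (by positivity), ← rpow_natCast]
      norm_num
    simp only [h3, heat, smul_eq_mul]
    push_cast
    rfl
  exact (Complex.continuous_re.tendsto _).comp h2

section pairing

variable {Ω Ω' : Type*} [MeasurableSpace Ω] [MeasurableSpace Ω']

/-- The transform `ξ ↦ ∫ e^{-i X·ξ} F dP` of a density `F` carried by a vector `X`. -/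
noncomputable def vecTransform (P : Measure Ω) (X : Ω → R3) (F : Ω → ℂ) (ξ : R3) : ℂ :=
  ∫ x, Complex.exp (-Complex.I * ((inner ℝ (X x) ξ : ℝ) : ℂ)) * F x ∂P

lemma norm_cexp_neg_I_mul (t : ℝ) : ‖Complex.exp (-Complex.I * (t : ℂ))‖ = 1 := by
  rw [Complex.norm_exp]; simp

/-- Plancherel's identity with a Gaussian cutoff. -/
lemma integral_vecTransform_mul_conj {P : Measure Ω} {P' : Measure Ω'} [SFinite P] [SFinite P']
    {X : Ω → R3} {X' : Ω' → R3} {F : Ω → ℂ} {F' : Ω' → ℂ} (hX : Measurable X)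
    (hX' : Measurable X') (hF : Integrable F P) (hF' : Integrable F' P') {c : ℝ} (hc : 0 < c) :
    ∫ ξ, vecTransform P X F ξ * starRingEnd ℂ (vecTransform P' X' F' ξ) *
        (heatMultiplier c ξ : ℂ) =
      (2 * π : ℂ) ^ 3 * ∫ p, F p.1 * starRingEnd ℂ (F' p.2) * (heat c (X p.1 - X' p.2) : ℂ)
        ∂(P.prod P') := by
  have h1 : ∀ ξ, vecTransform P X F ξ * starRingEnd ℂ (vecTransform P' X' F' ξ) *
      (heatMultiplier c ξ : ℂ) = ∫ p, (F p.1 * starRingEnd ℂ (F' p.2)) *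
        (Complex.exp (-Complex.I * ((inner ℝ (X p.1 - X' p.2) ξ : ℝ) : ℂ)) *
          (heatMultiplier c ξ : ℂ)) ∂(P.prod P') := by
    intro ξ
    unfold vecTransform
    rw [← integral_conj, ← integral_prod_mul, ← integral_mul_const]
    refine integral_congr_ae (Eventually.of_forall fun p => ?_)
    simp only [map_mul, ← Complex.exp_conj, map_neg, Complex.conj_I, Complex.conj_ofReal,
      inner_sub_left, Complex.ofReal_sub, mul_sub, neg_neg]
    rw [sub_eq_add_neg, Complex.exp_add, ← neg_mul, neg_neg]
    ring
  simp_rw [h1]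
  rw [integral_integral_swap, ← integral_const_mul]
  · refine integral_congr_ae (Eventually.of_forall fun p => ?_)
    simp only
    rw [integral_const_mul, integral_heatMultiplier_mul_cexp hc]
    push_cast
    ring
  · have hb : Integrable (fun q : R3 × (Ω × Ω') => (heatMultiplier c q.1 : ℂ) *
        (F q.2.1 * starRingEnd ℂ (F' q.2.2))) (volume.prod (P.prod P')) := by
      refine Integrable.mul_prod (f := fun ξ => (heatMultiplier c ξ : ℂ))
        (g := fun p : Ω × Ω' => F p.1 * starRingEnd ℂ (F' p.2))
        (integrable_heatMultiplier hc).ofReal ?_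
      exact Integrable.mul_prod (g := fun y => starRingEnd ℂ (F' y)) hF
        (Complex.conjLIE.toContinuousLinearEquiv.toContinuousLinearMap.integrable_comp hF')
    refine (hb.bdd_mul (c := 1) (f := fun q : R3 × (Ω × Ω') =>
      Complex.exp (-Complex.I * ((inner ℝ (X q.2.1 - X' q.2.2) q.1 : ℝ) : ℂ)))
      (by fun_prop) (Eventually.of_forall fun q => (norm_cexp_neg_I_mul _).le)).congr
      (Eventually.of_forall fun q => ?_)
    simp only [Function.uncurry]
    ring

end pairing

/-! ### Integrals over quadruples of points of the sphere -/

/-- Product measure on pairs of points of the sphere. -/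
noncomputable abbrev pairMeasure : Measure (S2 × S2) := surfaceMeasure.prod surfaceMeasure

/-- The mollification at scale `c` of the density of `σ * σ` weighted by `W`. -/
noncomputable def convMoll (W : R3 → ℝ) (c : ℝ) (v : R3) : ℝ :=
  ∫ w, convDensity w * (W w * heat c (v - w))

/-- Product measure on quadruples of points of the sphere. -/
noncomputable abbrev quadMeasure : Measure ((S2 × S2) × (S2 × S2)) := pairMeasure.prod pairMeasure

/-- The defect `x₁ + x₂ - x₃ - x₄` of a quadruple. -/
def defect (p : (S2 × S2) × (S2 × S2)) : R3 := (p.1.1 + p.1.2 : R3) - (p.2.1 + p.2.2)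

@[fun_prop]
lemma continuous_defect : Continuous defect := by unfold defect; fun_prop

lemma norm_defect_le (p) : ‖defect p‖ ≤ 4 := by
  unfold defect
  refine (norm_sub_le _ _).trans ?_
  have h1 := norm_add_le (p.1.1 : R3) p.1.2
  have h2 := norm_add_le (p.2.1 : R3) p.2.2
  simp only [norm_S2] at h1 h2
  linarith

@[fun_prop]
lemma measurable_convMoll {W : R3 → ℝ} (hW : Measurable W) (c : ℝ) :
    Measurable (convMoll W c) := by
  have : StronglyMeasurable (fun q : R3 × R3 => convDensity q.2 * (W q.2 * heat c (q.1 - q.2))) := by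
    refine Measurable.stronglyMeasurable ?_
    have := (continuous_heat c).measurable
    fun_prop
  exact this.integral_prod_right'.measurable

lemma convMoll_neg {W : R3 → ℝ} (hW : ∀ w, W (-w) = W w) (c : ℝ) (v : R3) :
    convMoll W c (-v) = convMoll W c v := by
  unfold convMoll
  rw [← integral_neg_eq_self]
  refine integral_congr_ae (Eventually.of_forall fun w => ?_)
  have : convDensity (-w) = convDensity w := by simp [convDensity]
  simp only [this, hW]
  rw [show -v - -w = -(v - w) by abel, heat_neg]

lemma convMoll_nonneg {W : R3 → ℝ} (hW : ∀ w, 0 ≤ W w) (c : ℝ) (v : R3) : 0 ≤ convMoll W c v :=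
  integral_nonneg fun w => mul_nonneg (convDensity_nonneg w) (mul_nonneg (hW w) (heat_nonneg _ _))

lemma measurePreserving_swap_quad : MeasurePreserving
    (fun p : (S2 × S2) × (S2 × S2) => (p.2, p.1)) quadMeasure quadMeasure :=
  Measure.measurePreserving_swap

lemma measurePreserving_13_24 : MeasurePreserving
    (fun p : (S2 × S2) × (S2 × S2) => ((p.1.1, p.2.1), (p.1.2, p.2.2))) quadMeasure quadMeasure := by
  have hi : MeasurePreserving (id : S2 → S2) surfaceMeasure surfaceMeasure := MeasurePreserving.id _
  have h1 : MeasurePreserving (fun p : S2 × (S2 × S2) => ((p.2.1, (p.1, p.2.2)) : S2 × (S2 × S2)))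
      (surfaceMeasure.prod pairMeasure) (surfaceMeasure.prod pairMeasure) := by
    have a := (measurePreserving_prodAssoc surfaceMeasure surfaceMeasure surfaceMeasure).symm
    have b := (Measure.measurePreserving_swap (μ := surfaceMeasure) (ν := surfaceMeasure)).prod hi
    have d := measurePreserving_prodAssoc surfaceMeasure surfaceMeasure surfaceMeasure
    exact d.comp (b.comp a)
  have a := measurePreserving_prodAssoc surfaceMeasure surfaceMeasure pairMeasure
  have b := hi.prod h1
  have d := (measurePreserving_prodAssoc surfaceMeasure surfaceMeasure pairMeasure).symm
  exact d.comp (b.comp a)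

lemma measurePreserving_24_13 : MeasurePreserving
    (fun p : (S2 × S2) × (S2 × S2) => ((p.1.2, p.2.2), (p.1.1, p.2.1))) quadMeasure quadMeasure :=
  measurePreserving_swap_quad.comp measurePreserving_13_24

lemma measurePreserving_swap_last : MeasurePreserving
    (fun p : (S2 × S2) × (S2 × S2) => (p.1, (p.2.2, p.2.1))) quadMeasure quadMeasure :=
  (MeasurePreserving.id pairMeasure).prod (Measure.measurePreserving_swap (μ := surfaceMeasure) (ν := surfaceMeasure))

lemma measurePreserving_14_23 : MeasurePreserving
    (fun p : (S2 × S2) × (S2 × S2) => ((p.1.1, p.2.2), (p.1.2, p.2.1))) quadMeasure quadMeasure :=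
  measurePreserving_13_24.comp measurePreserving_swap_last

lemma measurePreserving_23_14 : MeasurePreserving
    (fun p : (S2 × S2) × (S2 × S2) => ((p.1.2, p.2.1), (p.1.1, p.2.2))) quadMeasure quadMeasure :=
  measurePreserving_swap_quad.comp measurePreserving_14_23

/-- The integrand `G(x₁,x₂) W(x₃+x₄) heat(x₁+x₂-x₃-x₄)`. -/
noncomputable def addTerm (W : R3 → ℝ) (G : S2 × S2 → ℝ) (c : ℝ) (p : (S2 × S2) × (S2 × S2)) : ℝ :=
  G p.1 * (W (p.2.1 + p.2.2) * heat c (p.1.1 + p.1.2 - (p.2.1 + p.2.2)))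

/-- The integrand `G(x₁,x₂) W(x₃-x₄) heat(x₁-x₂+x₃-x₄)`. -/
noncomputable def subTerm (W : R3 → ℝ) (G : S2 × S2 → ℝ) (c : ℝ) (p : (S2 × S2) × (S2 × S2)) : ℝ :=
  G p.1 * (W (p.2.1 - p.2.2) * heat c (p.1.1 - p.1.2 + (p.2.1 - p.2.2)))

section terms

variable {W : R3 → ℝ} {G : S2 × S2 → ℝ} {c M : ℝ}

lemma integrable_quad_mul_bdd (hG : Integrable G pairMeasure) {H : (S2 × S2) × (S2 × S2) → ℝ}
    (hH : Measurable H) (hb : ∀ p, |H p| ≤ M) :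
    Integrable (fun p => G p.1 * H p) quadMeasure :=
  (hG.comp_fst pairMeasure).mul_bdd (c := M) hH.aestronglyMeasurable
    (Eventually.of_forall hb)

lemma norm_add_S2_le (x y : S2) : ‖(x : R3) + y‖ ≤ 2 := by
  have h1 := norm_add_le (x : R3) y
  simp only [norm_S2] at h1
  linarith

lemma norm_sub_S2_le (x y : S2) : ‖(x : R3) - y‖ ≤ 2 := by
  have h1 := norm_sub_le (x : R3) y
  simp only [norm_S2] at h1
  linarith

lemma integrable_addTerm (hc : 0 < c) (hW : Measurable W) (hM : ∀ w, ‖w‖ ≤ 2 → |W w| ≤ M)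
    (hG : Integrable G pairMeasure) : Integrable (addTerm W G c) quadMeasure := by
  have := (continuous_heat c).measurable
  refine integrable_quad_mul_bdd (M := M * √(π * c) ^ 3) hG (by fun_prop) fun p => ?_
  rw [abs_mul]
  exact mul_le_mul (hM _ (norm_add_S2_le _ _)) (abs_heat_le hc _) (abs_nonneg _)
    ((abs_nonneg _).trans (hM 0 (by simp)))

lemma integrable_subTerm (hc : 0 < c) (hW : Measurable W) (hM : ∀ w, ‖w‖ ≤ 2 → |W w| ≤ M)
    (hG : Integrable G pairMeasure) : Integrable (subTerm W G c) quadMeasure := by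
  have := (continuous_heat c).measurable
  refine integrable_quad_mul_bdd (M := M * √(π * c) ^ 3) hG (by fun_prop) fun p => ?_
  rw [abs_mul]
  exact mul_le_mul (hM _ (norm_sub_S2_le _ _)) (abs_heat_le hc _) (abs_nonneg _)
    ((abs_nonneg _).trans (hM 0 (by simp)))

lemma integral_addTerm (hc : 0 < c) (hW : Measurable W) (hM : ∀ w, ‖w‖ ≤ 2 → |W w| ≤ M)
    (hG : Integrable G pairMeasure) :
    ∫ p, addTerm W G c p ∂quadMeasure = ∫ q, G q * convMoll W c (q.1 + q.2) ∂pairMeasure := by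
  have := (continuous_heat c).measurable
  rw [integral_prod _ (integrable_addTerm hc hW hM hG)]
  refine integral_congr_ae (Eventually.of_forall fun q => ?_)
  simp only [addTerm]
  rw [integral_const_mul, integral_add_eq_integral_convDensity
    (F := fun w => W w * heat c (q.1 + q.2 - w)) (by fun_prop)]
  rfl

lemma integral_subTerm (hc : 0 < c) (hW : Measurable W) (hM : ∀ w, ‖w‖ ≤ 2 → |W w| ≤ M)
    (hW' : ∀ w, W (-w) = W w) (hG : Integrable G pairMeasure) :
    ∫ p, subTerm W G c p ∂quadMeasure = ∫ q, G q * convMoll W c (q.1 - q.2) ∂pairMeasure := by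
  have := (continuous_heat c).measurable
  rw [integral_prod _ (integrable_subTerm hc hW hM hG)]
  refine integral_congr_ae (Eventually.of_forall fun q => ?_)
  simp only [subTerm]
  rw [integral_const_mul, integral_sub_eq_integral_convDensity
    (F := fun w => W w * heat c (q.1 - q.2 + w)) (by fun_prop), ← convMoll_neg hW']
  unfold convMoll
  congr 2
  ext w
  rw [show -((q.1 : R3) - q.2) - w = -(q.1 - q.2 + w) by abel, heat_neg]

end terms

lemma integral_comp_of_measurePreserving {τ : (S2 × S2) × (S2 × S2) → (S2 × S2) × (S2 × S2)}
    (hτ : MeasurePreserving τ quadMeasure quadMeasure) {H : (S2 × S2) × (S2 × S2) → ℝ}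
    (hH : Integrable H quadMeasure) :
    ∫ p, H (τ p) ∂quadMeasure = ∫ p, H p ∂quadMeasure := by
  have h := integral_map (μ := quadMeasure) (φ := τ) (f := H) hτ.measurable.aemeasurable
    (by rw [hτ.map_eq]; exact hH.aestronglyMeasurable)
  rw [hτ.map_eq] at h
  exact h.symm

/-! ### The geometric identity and the bound by the mollified energy -/

/-- The mollified multiple `|w|² (σ * σ)(w) = 2π |w|` of the norm. -/
noncomputable abbrev normMoll (c : ℝ) (v : R3) : ℝ := convMoll (fun w => ‖w‖ ^ 2) c v

lemma convDensity_mul_sq (w : R3) :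
    convDensity w * ‖w‖ ^ 2 = if ‖w‖ < 2 then 2 * π * ‖w‖ else 0 := by
  unfold convDensity
  split_ifs with h
  · by_cases h0 : ‖w‖ = 0
    · simp [h0]
    · field_simp
  · simp

lemma convDensity_mul_sq_le (w : R3) : convDensity w * ‖w‖ ^ 2 ≤ 4 * π := by
  rw [convDensity_mul_sq]
  split_ifs with h
  · nlinarith [pi_pos]
  · positivity

lemma integrable_convDensity_mul_sq : Integrable fun w => convDensity w * ‖w‖ ^ 2 := by
  refine (integrable_convDensity.mul_const 4).mono' (by fun_prop)
    (Eventually.of_forall fun w => ?_)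
  have := convDensity_nonneg w
  rw [Real.norm_eq_abs, abs_of_nonneg (by positivity)]
  by_cases h : ‖w‖ < 2
  · have : ‖w‖ ^ 2 ≤ 4 := by nlinarith [norm_nonneg w]
    gcongr
  · simp [convDensity, h]

lemma normMoll_nonneg (c : ℝ) (v : R3) : 0 ≤ normMoll c v := convMoll_nonneg (fun _ => sq_nonneg _) c v

lemma normMoll_le {c : ℝ} (hc : 0 < c) (v : R3) : normMoll c v ≤ 4 * π := by
  have h : ∫ w, heat c (v - w) * (4 * π) = 4 * π := by
    rw [integral_mul_const, integral_heat_sub hc, one_mul]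
  rw [← h]
  refine integral_mono_of_nonneg (Eventually.of_forall fun w => ?_)
    ((integrable_heat_sub hc v).mul_const _) (Eventually.of_forall fun w => ?_)
  · have := convDensity_nonneg w
    have := heat_nonneg c (v - w)
    simp only [Pi.zero_apply]
    positivity
  · simp only
    rw [← mul_assoc, mul_comm]
    exact mul_le_mul_of_nonneg_left (convDensity_mul_sq_le w) (heat_nonneg _ _)

lemma tendsto_normMoll {v : R3} (hv : ‖v‖ < 2) :
    Tendsto (fun c => normMoll c v) atTop (𝓝 (2 * π * ‖v‖)) := by
  have hcont : ContinuousAt (fun w => convDensity w * ‖w‖ ^ 2) v := by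
    have h : (fun w : R3 => convDensity w * ‖w‖ ^ 2) =ᶠ[𝓝 v] fun w => 2 * π * ‖w‖ := by
      filter_upwards [(isOpen_lt continuous_norm continuous_const).mem_nhds hv] with w hw
      rw [convDensity_mul_sq, if_pos hw]
    exact (continuousAt_congr h).2 (by fun_prop)
  have := tendsto_integral_heat_mul integrable_convDensity_mul_sq hcont
  rw [convDensity_mul_sq, if_pos hv] at this
  refine this.congr fun c => ?_
  unfold normMoll convMoll
  refine integral_congr_ae (Eventually.of_forall fun w => ?_)
  simp only
  ring

/-- The mollified energy `2 ∬ g g L(x+y) + 4 ∬ g g L(x-y)`. -/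
noncomputable def mollEnergy (c : ℝ) (g : S2 → ℝ) : ℝ :=
  2 * ∫ q, g q.1 * g q.2 * normMoll c (q.1 + q.2) ∂pairMeasure +
    4 * ∫ q, g q.1 * g q.2 * normMoll c (q.1 - q.2) ∂pairMeasure

/-- The energy `2 ∬ g(x) g(y) |x + y| + 4 ∬ g(x) g(y) |x - y|` on the sphere. -/
noncomputable def energy (g : S2 → ℝ) : ℝ :=
  2 * ∫ q, g q.1 * g q.2 * ‖(q.1 + q.2 : R3)‖ ∂pairMeasure +
    4 * ∫ q, g q.1 * g q.2 * ‖(q.1 - q.2 : R3)‖ ∂pairMeasure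

lemma tendsto_integral_normMoll {G : S2 × S2 → ℝ} (hG : Integrable G pairMeasure)
    {X : S2 × S2 → R3} (hX : Measurable X) (h2 : ∀ᵐ q ∂pairMeasure, ‖X q‖ < 2) :
    Tendsto (fun c => ∫ q, G q * normMoll c (X q) ∂pairMeasure) atTop
      (𝓝 (2 * π * ∫ q, G q * ‖X q‖ ∂pairMeasure)) := by
  have h : 2 * π * ∫ q, G q * ‖X q‖ ∂pairMeasure =
      ∫ q, G q * (2 * π * ‖X q‖) ∂pairMeasure := by
    rw [← integral_const_mul]
    congr 1; ext q; ring
  rw [h]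
  refine tendsto_integral_filter_of_dominated_convergence (fun q => |G q| * (4 * π)) ?_ ?_
    (hG.abs.mul_const _) ?_
  · refine Eventually.of_forall fun c => hG.aestronglyMeasurable.mul ?_
    have : Measurable (normMoll c) := measurable_convMoll (by fun_prop) c
    exact (this.comp hX).aestronglyMeasurable
  · filter_upwards [eventually_gt_atTop 0] with c hc
    refine Eventually.of_forall fun q => ?_
    rw [norm_mul, Real.norm_eq_abs, Real.norm_eq_abs, abs_of_nonneg (normMoll_nonneg _ _)]
    exact mul_le_mul_of_nonneg_left (normMoll_le hc _) (abs_nonneg _)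
  · filter_upwards [h2] with q hq
    exact (tendsto_normMoll hq).const_mul _

lemma tendsto_mollEnergy {g : S2 → ℝ} (hg : Integrable g surfaceMeasure) :
    Tendsto (fun c => mollEnergy c g) atTop (𝓝 (2 * π * energy g)) := by
  have hG : Integrable (fun q : S2 × S2 => g q.1 * g q.2) pairMeasure := hg.mul_prod hg
  have h1 := tendsto_integral_normMoll hG (X := fun q => (q.1 + q.2 : R3)) (by fun_prop)
    ae_norm_add_lt_two
  have h2 := tendsto_integral_normMoll hG (X := fun q => (q.1 - q.2 : R3)) (by fun_prop)
    ae_norm_sub_lt_two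
  have := (h1.const_mul 2).add (h2.const_mul 4)
  convert! this using 2
  unfold energy; ring

/-- The product `F(x₁) F(x₂) F(x₃) F(x₄)`. -/
def prodFour (F : S2 → ℝ) (p : (S2 × S2) × (S2 × S2)) : ℝ :=
  (F p.1.1 * F p.1.2) * (F p.2.1 * F p.2.2)

lemma integrable_prodFour {F : S2 → ℝ} (hF : Integrable F surfaceMeasure) :
    Integrable (prodFour F) quadMeasure := (hF.mul_prod hF).mul_prod (hF.mul_prod hF)

/-- The Gaussian regularization of `(2π)⁻³ ‖(Fσ)^‖₄⁴`, for real `F`. -/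
noncomputable def quadForm (c : ℝ) (F : S2 → ℝ) : ℝ :=
  ∫ p, prodFour F p * heat c (defect p) ∂quadMeasure

/-- The contribution of quadruples with nonzero defect. -/
noncomputable def quadError (c : ℝ) (F : S2 → ℝ) : ℝ :=
  ∫ p, prodFour F p * (‖defect p‖ ^ 2 * heat c (defect p)) ∂quadMeasure

lemma integrable_mul_heat_defect {c : ℝ} (hc : 0 < c) {P : (S2 × S2) × (S2 × S2) → ℝ}
    (hP : Integrable P quadMeasure) :
    Integrable (fun p => P p * heat c (defect p)) quadMeasure :=
  hP.mul_bdd (c := √(π * c) ^ 3) (by fun_prop) (Eventually.of_forall fun p => abs_heat_le hc _)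

lemma integrable_mul_sq_heat_defect {c : ℝ} (hc : 0 < c) {P : (S2 × S2) × (S2 × S2) → ℝ}
    (hP : Integrable P quadMeasure) :
    Integrable (fun p => P p * (‖defect p‖ ^ 2 * heat c (defect p))) quadMeasure := by
  refine hP.mul_bdd (c := 4 ^ 2 * √(π * c) ^ 3) (by fun_prop) (Eventually.of_forall fun p => ?_)
  rw [norm_mul, norm_pow, norm_norm]
  have := norm_defect_le p
  exact mul_le_mul (by gcongr) (abs_heat_le hc _) (norm_nonneg _) (by positivity)

lemma norm_sq_S2 (x : S2) : inner ℝ (x : R3) (x : R3) = 1 := by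
  rw [real_inner_self_eq_norm_sq, norm_S2]; norm_num

/-- The identity on quadruples of unit vectors behind the inequality: when the defect vanishes, the
squared lengths attached to the three pairings add up to a constant. -/
lemma sum_norm_sq_pairs (p : (S2 × S2) × (S2 × S2)) :
    ‖(p.1.1 + p.1.2 : R3)‖ ^ 2 + ‖(p.2.1 + p.2.2 : R3)‖ ^ 2 +
      (‖(p.1.1 - p.2.1 : R3)‖ ^ 2 + ‖(p.1.2 - p.2.2 : R3)‖ ^ 2) +
      (‖(p.1.1 - p.2.2 : R3)‖ ^ 2 + ‖(p.1.2 - p.2.1 : R3)‖ ^ 2) = 8 + ‖defect p‖ ^ 2 := by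
  unfold defect
  simp only [← real_inner_self_eq_norm_sq, inner_add_left, inner_add_right, inner_sub_left,
    inner_sub_right, norm_sq_S2]
  rw [real_inner_comm (p.1.1 : R3) p.1.2, real_inner_comm (p.1.1 : R3) p.2.1,
    real_inner_comm (p.1.1 : R3) p.2.2, real_inner_comm (p.1.2 : R3) p.2.1,
    real_inner_comm (p.1.2 : R3) p.2.2, real_inner_comm (p.2.1 : R3) p.2.2]
  ring

lemma pairing_le {p q a b d : ℝ} (hab : 0 ≤ a * b) (hd : |p - q| ≤ d) :
    (p ^ 2 + q ^ 2) * (a * b) ≤ p ^ 2 * b ^ 2 + q ^ 2 * a ^ 2 + d ^ 2 * (a * b) := by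
  have h : (p - q) ^ 2 ≤ d ^ 2 := sq_le_sq' (by linarith [(abs_le.1 hd).1]) (abs_le.1 hd).2
  nlinarith [sq_nonneg (p * b - q * a), mul_nonneg (sub_nonneg.2 h) hab]

/-- The six weighted terms attached to the three pairings of a quadruple. -/
noncomputable def pairTerms (c : ℝ) (G : S2 × S2 → ℝ) (p : (S2 × S2) × (S2 × S2)) : ℝ :=
  addTerm (fun w => ‖w‖ ^ 2) G c p + addTerm (fun w => ‖w‖ ^ 2) G c (p.2, p.1) +
    (subTerm (fun w => ‖w‖ ^ 2) G c ((p.1.1, p.2.1), (p.1.2, p.2.2)) +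
      subTerm (fun w => ‖w‖ ^ 2) G c ((p.1.2, p.2.2), (p.1.1, p.2.1))) +
    (subTerm (fun w => ‖w‖ ^ 2) G c ((p.1.1, p.2.2), (p.1.2, p.2.1)) +
      subTerm (fun w => ‖w‖ ^ 2) G c ((p.1.2, p.2.1), (p.1.1, p.2.2)))

lemma pairTerms_eq (c : ℝ) (G : S2 × S2 → ℝ) (p : (S2 × S2) × (S2 × S2)) :
    pairTerms c G p = heat c (defect p) *
      (‖(p.1.1 + p.1.2 : R3)‖ ^ 2 * G p.2 + ‖(p.2.1 + p.2.2 : R3)‖ ^ 2 * G p.1 +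
      (‖(p.1.1 - p.2.1 : R3)‖ ^ 2 * G (p.1.2, p.2.2) +
        ‖(p.1.2 - p.2.2 : R3)‖ ^ 2 * G (p.1.1, p.2.1)) +
      (‖(p.1.1 - p.2.2 : R3)‖ ^ 2 * G (p.1.2, p.2.1) +
        ‖(p.1.2 - p.2.1 : R3)‖ ^ 2 * G (p.1.1, p.2.2))) := by
  have e1 : (p.1.1 + p.1.2 - (p.2.1 + p.2.2) : R3) = defect p := rfl
  have e2 : (p.2.1 + p.2.2 - (p.1.1 + p.1.2) : R3) = -defect p := by unfold defect; abel
  have e3 : (p.1.1 - p.2.1 + (p.1.2 - p.2.2) : R3) = defect p := by unfold defect; abel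
  have e4 : (p.1.2 - p.2.2 + (p.1.1 - p.2.1) : R3) = defect p := by unfold defect; abel
  have e5 : (p.1.1 - p.2.2 + (p.1.2 - p.2.1) : R3) = defect p := by unfold defect; abel
  have e6 : (p.1.2 - p.2.1 + (p.1.1 - p.2.2) : R3) = defect p := by unfold defect; abel
  simp only [pairTerms, addTerm, subTerm, e1, e2, e3, e4, e5, e6, heat_neg]
  ring

lemma integral_pairTerms {c : ℝ} (hc : 0 < c) {g : S2 → ℝ} (hg : Integrable g surfaceMeasure) :
    Integrable (pairTerms c fun q => g q.1 * g q.2) quadMeasure ∧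
      ∫ p, pairTerms c (fun q => g q.1 * g q.2) p ∂quadMeasure = mollEnergy c g := by
  have hG : Integrable (fun q : S2 × S2 => g q.1 * g q.2) pairMeasure := hg.mul_prod hg
  have hWm : Measurable fun w : R3 => ‖w‖ ^ 2 := by fun_prop
  have hW : ∀ w : R3, ‖w‖ ≤ 2 → |‖w‖ ^ 2| ≤ 4 := fun w hw => by
    rw [abs_of_nonneg (by positivity)]; nlinarith [norm_nonneg w]
  have ha := integrable_addTerm hc hWm hW hG
  have hs := integrable_subTerm hc hWm hW hG
  have ia := integral_addTerm hc hWm hW hG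
  have is := integral_subTerm hc hWm hW (by simp) hG
  have i1 := measurePreserving_swap_quad.integrable_comp_of_integrable ha
  have i2 := measurePreserving_13_24.integrable_comp_of_integrable hs
  have i3 := measurePreserving_24_13.integrable_comp_of_integrable hs
  have i4 := measurePreserving_14_23.integrable_comp_of_integrable hs
  have i5 := measurePreserving_23_14.integrable_comp_of_integrable hs
  have e1 := integral_comp_of_measurePreserving measurePreserving_swap_quad ha
  have e2 := integral_comp_of_measurePreserving measurePreserving_13_24 hs
  have e3 := integral_comp_of_measurePreserving measurePreserving_24_13 hs
  have e4 := integral_comp_of_measurePreserving measurePreserving_14_23 hs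
  have e5 := integral_comp_of_measurePreserving measurePreserving_23_14 hs
  refine ⟨((ha.add i1).add (i2.add i3)).add (i4.add i5), ?_⟩
  have e := integral_add' ((ha.add i1).add (i2.add i3)) (i4.add i5)
  rw [integral_add' (ha.add i1) (i2.add i3), integral_add' ha i1, integral_add' i2 i3,
    integral_add' i4 i5] at e
  simp only [Function.comp_def] at e
  rw [e1, e2, e3, e4, e5, ia, is] at e
  refine Eq.trans e ?_
  unfold mollEnergy
  ring

lemma integrable_of_sq {F : S2 → ℝ} (hF : MemLp F 2 surfaceMeasure) : Integrable F surfaceMeasure :=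
  hF.integrable (by norm_num)

lemma quadForm_le {c : ℝ} (hc : 0 < c) {F : S2 → ℝ} (hF : MemLp F 2 surfaceMeasure)
    (h0 : ∀ x, 0 ≤ F x) :
    8 * quadForm c F ≤ mollEnergy c (fun x => F x ^ 2) + 2 * quadError c F := by
  have hP := integrable_prodFour (integrable_of_sq hF)
  obtain ⟨hi, he⟩ := integral_pairTerms hc hF.integrable_sq
  have h1 := integrable_mul_heat_defect hc hP
  have h2 := integrable_mul_sq_heat_defect hc hP
  rw [← he, quadForm, quadError, ← integral_const_mul, ← integral_const_mul,
    ← integral_add hi (h2.const_mul 2)]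
  refine integral_mono (h1.const_mul 8) (hi.add (h2.const_mul 2)) fun p => ?_
  simp only
  rw [pairTerms_eq]
  have hid := sum_norm_sq_pairs p
  have hab : ∀ x y z w : S2, 0 ≤ (F x * F y) * (F z * F w) := fun x y z w => by
    have := h0 x; have := h0 y; have := h0 z; have := h0 w; positivity
  have t1 := pairing_le (hab p.1.1 p.1.2 p.2.1 p.2.2)
    (abs_norm_sub_norm_le (p.1.1 + p.1.2 : R3) (p.2.1 + p.2.2 : R3))
  have t2 := pairing_le (hab p.1.1 p.2.1 p.1.2 p.2.2)
    (abs_norm_sub_norm_le (p.1.1 - p.2.1 : R3) (p.2.2 - p.1.2 : R3))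
  have t3 := pairing_le (hab p.1.1 p.2.2 p.1.2 p.2.1)
    (abs_norm_sub_norm_le (p.1.1 - p.2.2 : R3) (p.2.1 - p.1.2 : R3))
  have e2 : (p.1.1 - p.2.1 - (p.2.2 - p.1.2) : R3) = defect p := by unfold defect; abel
  have e3 : (p.1.1 - p.2.2 - (p.2.1 - p.1.2) : R3) = defect p := by unfold defect; abel
  rw [show (p.1.1 + p.1.2 - (p.2.1 + p.2.2) : R3) = defect p from rfl] at t1
  rw [e2, norm_sub_rev (p.2.2 : R3)] at t2
  rw [e3, norm_sub_rev (p.2.1 : R3)] at t3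
  have hh := heat_nonneg c (defect p)
  have key : 8 * prodFour F p ≤ (‖(p.1.1 + p.1.2 : R3)‖ ^ 2 * (F p.2.1 ^ 2 * F p.2.2 ^ 2) +
      ‖(p.2.1 + p.2.2 : R3)‖ ^ 2 * (F p.1.1 ^ 2 * F p.1.2 ^ 2) +
      (‖(p.1.1 - p.2.1 : R3)‖ ^ 2 * (F p.1.2 ^ 2 * F p.2.2 ^ 2) +
        ‖(p.1.2 - p.2.2 : R3)‖ ^ 2 * (F p.1.1 ^ 2 * F p.2.1 ^ 2)) +
      (‖(p.1.1 - p.2.2 : R3)‖ ^ 2 * (F p.1.2 ^ 2 * F p.2.1 ^ 2) +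
        ‖(p.1.2 - p.2.1 : R3)‖ ^ 2 * (F p.1.1 ^ 2 * F p.2.2 ^ 2))) +
      2 * (prodFour F p * ‖defect p‖ ^ 2) := by
    unfold prodFour
    linear_combination t1 + t2 + t3 - (F p.1.1 * F p.1.2 * (F p.2.1 * F p.2.2)) * hid
  linear_combination (heat c (defect p)) * key

lemma quadForm_one {c : ℝ} (hc : 0 < c) :
    8 * quadForm c (fun _ => 1) = mollEnergy c (fun _ => 1) - quadError c (fun _ => 1) := by
  have hP := integrable_prodFour (integrable_const (μ := surfaceMeasure) (1 : ℝ))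
  obtain ⟨hi, he⟩ := integral_pairTerms hc (integrable_const (μ := surfaceMeasure) (1 : ℝ))
  have h1 := integrable_mul_heat_defect hc hP
  have h2 := integrable_mul_sq_heat_defect hc hP
  rw [← he, quadForm, quadError, ← integral_const_mul, ← integral_sub hi h2]
  refine integral_congr_ae (Eventually.of_forall fun p => ?_)
  simp only
  rw [pairTerms_eq]
  have hid := sum_norm_sq_pairs p
  unfold prodFour
  linear_combination (-heat c (defect p)) * hid

/-! ### Removal of the regularization -/

lemma tendsto_heat_tail {a : ℝ} (ha : 0 < a) :
    Tendsto (fun c => √(π * c) ^ 3 * exp (-a * c)) atTop (𝓝 0) := by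
  have h := (tendsto_rpow_mul_exp_neg_mul_atTop_nhds_zero (3 / 2) a ha).const_mul (√π ^ 3)
  rw [mul_zero] at h
  refine h.congr' ?_
  filter_upwards [eventually_gt_atTop 0] with c hc
  have : c ^ ((3 : ℝ) / 2) = √c ^ 3 := by
    nth_rw 1 [← sq_sqrt hc.le]
    rw [← rpow_natCast, ← rpow_natCast, ← rpow_mul (by positivity)]
    norm_num
  rw [this, sqrt_mul pi_pos.le]
  ring

lemma sq_mul_heat_le {c η : ℝ} (hc : 0 < c) (hη : 0 < η) {v : R3} (hv : ‖v‖ ≤ 4) :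
    ‖v‖ ^ 2 * heat c v ≤ η ^ 2 * heat c v + 16 * (√(π * c) ^ 3 * exp (-(π ^ 2 * η ^ 2) * c)) := by
  have h0 := heat_nonneg c v
  by_cases h : ‖v‖ ≤ η
  · have : ‖v‖ ^ 2 ≤ η ^ 2 := by gcongr
    have h2 : 0 ≤ 16 * (√(π * c) ^ 3 * exp (-(π ^ 2 * η ^ 2) * c)) := by positivity
    nlinarith
  · have h1 : heat c v ≤ √(π * c) ^ 3 * exp (-(π ^ 2 * η ^ 2) * c) := by
      unfold heat
      refine mul_le_mul_of_nonneg_left (exp_le_exp.2 ?_) (by positivity)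
      have : η ^ 2 ≤ ‖v‖ ^ 2 := by gcongr; exact (not_le.1 h).le
      have := mul_le_mul_of_nonneg_left this (show 0 ≤ π ^ 2 * c by positivity)
      linarith
    have h2 : ‖v‖ ^ 2 ≤ 16 := by nlinarith [norm_nonneg v]
    have := mul_le_mul h2 h1 h0 (by norm_num)
    have : 0 ≤ η ^ 2 * heat c v := by positivity
    linarith

lemma prodFour_nonneg {F : S2 → ℝ} (h0 : ∀ x, 0 ≤ F x) (p) : 0 ≤ prodFour F p :=
  mul_nonneg (mul_nonneg (h0 _) (h0 _)) (mul_nonneg (h0 _) (h0 _))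

section limits

variable {F : S2 → ℝ}

lemma quadError_nonneg (h0 : ∀ x, 0 ≤ F x) (c : ℝ) : 0 ≤ quadError c F :=
  integral_nonneg fun p => mul_nonneg (prodFour_nonneg h0 p)
    (mul_nonneg (sq_nonneg _) (heat_nonneg _ _))

lemma quadError_le (hF : Integrable F surfaceMeasure) (h0 : ∀ x, 0 ≤ F x) {c η : ℝ} (hc : 0 < c)
    (hη : 0 < η) :
    quadError c F ≤ η ^ 2 * quadForm c F + 16 * (√(π * c) ^ 3 * exp (-(π ^ 2 * η ^ 2) * c)) *
      ∫ p, prodFour F p ∂quadMeasure := by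
  have hP := integrable_prodFour hF
  have h1 := integrable_mul_heat_defect hc hP
  unfold quadError quadForm
  rw [← integral_const_mul, ← integral_const_mul, ← integral_add (h1.const_mul _) (hP.const_mul _)]
  refine integral_mono (integrable_mul_sq_heat_defect hc hP)
    ((h1.const_mul _).add (hP.const_mul _)) fun p => ?_
  have := mul_le_mul_of_nonneg_left (sq_mul_heat_le hc hη (norm_defect_le p))
    (prodFour_nonneg h0 p)
  simp only
  linarith

lemma tendsto_quadError (hF : MemLp F 2 surfaceMeasure) (h0 : ∀ x, 0 ≤ F x) :
    Tendsto (fun c => quadError c F) atTop (𝓝 0) := by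
  have hF1 := integrable_of_sq hF
  set I := ∫ p, prodFour F p ∂quadMeasure
  have htail : ∀ η : ℝ, 0 < η → Tendsto (fun c =>
      16 * (√(π * c) ^ 3 * exp (-(π ^ 2 * η ^ 2) * c)) * I) atTop (𝓝 0) := fun η hη => by
    have := ((tendsto_heat_tail (a := π ^ 2 * η ^ 2) (by positivity)).const_mul 16).mul_const I
    simpa using this
  -- the choice `η = 1` bounds the quadratic form, uniformly in the scale
  obtain ⟨M, hM⟩ : ∃ M, ∀ᶠ c in atTop, quadForm c F ≤ M := by
    have hlim := (tendsto_mollEnergy hF.integrable_sq).add ((htail 1 one_pos).const_mul 2)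
    refine ⟨(2 * π * energy (fun x => F x ^ 2) + 2 * 0 + 1) / 6, ?_⟩
    filter_upwards [eventually_gt_atTop 0, hlim.eventually_le_const (lt_add_one _)] with c hc h1
    have h2 := quadForm_le hc hF h0
    have h3 := quadError_le hF1 h0 hc one_pos
    rw [le_div_iff₀ (by norm_num)]
    linarith
  rw [Metric.tendsto_atTop']
  intro ε hε
  obtain ⟨η, hη, hηM⟩ : ∃ η : ℝ, 0 < η ∧ η ^ 2 * (|M| + 1) = ε / 2 :=
    ⟨√(ε / 2 / (|M| + 1)), by positivity, by rw [sq_sqrt (by positivity)]; field_simp⟩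
  have hev : ∀ᶠ c in atTop, dist (quadError c F) 0 < ε := by
    filter_upwards [eventually_gt_atTop 0, hM,
      (htail η hη).eventually_lt_const (half_pos hε)] with c hc h1 h2
    rw [Real.dist_eq, sub_zero, abs_of_nonneg (quadError_nonneg h0 c)]
    have h3 := quadError_le hF1 h0 hc hη
    have h4 : quadForm c F ≤ |M| + 1 := by linarith [le_abs_self M]
    have h5 := mul_le_mul_of_nonneg_left h4 (sq_nonneg η)
    linarith
  obtain ⟨N, hN⟩ := eventually_atTop.1 hev
  exact ⟨N, fun n hn => hN n hn.le⟩

/-- In the limit, the quadratic form is bounded by the energy of `F²`. -/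
lemma exists_tendsto_quadForm_le (hF : MemLp F 2 surfaceMeasure) (h0 : ∀ x, 0 ≤ F x) :
    ∃ U : ℝ → ℝ, Tendsto U atTop (𝓝 (π / 4 * energy fun x => F x ^ 2)) ∧
      ∀ c, 0 < c → quadForm c F ≤ U c := by
  refine ⟨fun c => (mollEnergy c (fun x => F x ^ 2) + 2 * quadError c F) / 8, ?_, fun c hc => ?_⟩
  · have := ((tendsto_mollEnergy hF.integrable_sq).add
      ((tendsto_quadError hF h0).const_mul 2)).div_const 8
    convert! this using 2
    ring
  · rw [le_div_iff₀ (by norm_num)]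
    linarith [quadForm_le hc hF h0]

/-- For constants the bound by the energy is attained. -/
lemma tendsto_quadForm_one :
    Tendsto (fun c => quadForm c fun _ => 1) atTop (𝓝 (π / 4 * energy fun _ => 1)) := by
  have h1 := tendsto_quadError (F := fun _ => 1) (memLp_const 1) (fun _ => zero_le_one)
  have h2 := tendsto_mollEnergy (g := fun _ => 1) (integrable_const 1)
  have h3 := (h2.sub h1).div_const 8
  have : (2 * π * energy (fun _ => 1) - 0) / 8 = π / 4 * energy fun _ => 1 := by ring
  rw [this] at h3
  refine h3.congr' ?_
  filter_upwards [eventually_gt_atTop 0] with c hc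
  rw [← quadForm_one hc]; ring

end limits

/-! ### Gaussian superpositions and positive definiteness -/

/-- The kernel representing the norm as a superposition of Gaussians. -/
noncomputable def gaussGap (a u : ℝ) : ℝ := (1 - exp (-(a ^ 2 * u ^ 2))) / u ^ 2

lemma gaussGap_nonneg (a u : ℝ) : 0 ≤ gaussGap a u := by
  unfold gaussGap
  refine div_nonneg (sub_nonneg.2 (exp_le_one_iff.2 ?_)) (sq_nonneg u)
  have : 0 ≤ a ^ 2 * u ^ 2 := by positivity
  linarith

lemma gaussGap_le (a u : ℝ) : gaussGap a u ≤ (1 + a ^ 2) * (1 + u ^ 2)⁻¹ := by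
  rw [← div_eq_mul_inv, le_div_iff₀ (by positivity)]
  by_cases hu : u = 0
  · simp [gaussGap, hu]; positivity
  have h1 : gaussGap a u * u ^ 2 ≤ 1 := by
    unfold gaussGap
    rw [div_mul_cancel₀ _ (by positivity)]
    linarith [exp_pos (-(a ^ 2 * u ^ 2))]
  have h2 : gaussGap a u ≤ a ^ 2 := by
    unfold gaussGap
    rw [div_le_iff₀ (by positivity)]
    linarith [add_one_le_exp (-(a ^ 2 * u ^ 2))]
  linarith

@[fun_prop]
lemma measurable_gaussGap : Measurable (Function.uncurry gaussGap) := by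
  unfold gaussGap Function.uncurry; fun_prop

lemma integrable_gaussGap (a : ℝ) : Integrable (gaussGap a) := by
  refine (integrable_inv_one_add_sq.const_mul (1 + a ^ 2)).mono' ?_
    (Eventually.of_forall fun u => ?_)
  · exact (measurable_gaussGap.comp (measurable_const.prodMk measurable_id)).aestronglyMeasurable
  · rw [Real.norm_eq_abs, abs_of_nonneg (gaussGap_nonneg a u)]
    exact gaussGap_le a u

/-- `|a|` is a superposition of the functions `1 - e^{-a²u²}`. -/
lemma integral_gaussGap {a : ℝ} (ha : 0 ≤ a) : ∫ u, gaussGap a u = a * ∫ u, gaussGap 1 u := by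
  rcases ha.eq_or_lt with rfl | ha
  · simp [gaussGap]
  have h := Measure.integral_comp_mul_left (gaussGap 1) a
  have h2 : ∀ u, gaussGap a u = a ^ 2 * gaussGap 1 (a * u) := fun u => by
    unfold gaussGap
    by_cases hu : u = 0
    · simp [hu]
    · field_simp
  simp_rw [h2]
  rw [integral_const_mul, h, abs_of_pos (inv_pos.2 ha), smul_eq_mul]
  field_simp

lemma integral_gaussGap_one_pos : 0 < ∫ u, gaussGap 1 u := by
  rw [integral_pos_iff_support_of_nonneg (gaussGap_nonneg 1) (integrable_gaussGap 1)]
  have : Ioi (0 : ℝ) ⊆ Function.support (gaussGap 1) := by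
    intro u hu
    have hu' : (0 : ℝ) < u := hu
    have h1 : exp (-(1 ^ 2 * u ^ 2)) < 1 := by
      rw [exp_lt_one_iff, one_pow, one_mul]; exact neg_neg_of_pos (by positivity)
    have : 0 < gaussGap 1 u := div_pos (by linarith) (by positivity)
    exact this.ne'
  exact lt_of_lt_of_le (by simp) (measure_mono this)

section transform

lemma continuous_vecTransform {Ω : Type*} [MeasurableSpace Ω] {P : Measure Ω} {X : Ω → R3}
    {F : Ω → ℂ} (hX : Measurable X) (hF : Integrable F P) : Continuous (vecTransform P X F) := by
  unfold vecTransform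
  refine continuous_of_dominated (bound := fun x => ‖F x‖) (fun ξ => ?_)
    (fun ξ => Eventually.of_forall fun x => ?_) hF.norm (Eventually.of_forall fun x => by fun_prop)
  · exact AEStronglyMeasurable.mul (by fun_prop) hF.aestronglyMeasurable
  · rw [norm_mul, norm_cexp_neg_I_mul, one_mul]

lemma norm_vecTransform_le {Ω : Type*} [MeasurableSpace Ω] {P : Measure Ω} {X : Ω → R3}
    {F : Ω → ℂ} (ξ : R3) : ‖vecTransform P X F ξ‖ ≤ ∫ x, ‖F x‖ ∂P := by
  unfold vecTransform
  refine (norm_integral_le_integral_norm _).trans_eq ?_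
  simp_rw [norm_mul, norm_cexp_neg_I_mul, one_mul]

/-- A real density on the sphere with vanishing Fourier transform vanishes. -/
lemma ae_eq_zero_of_vecTransform_eq_zero {h : S2 → ℝ} (hh : Integrable h surfaceMeasure)
    (h0 : ∀ ξ, vecTransform surfaceMeasure Subtype.val (fun x => (h x : ℂ)) ξ = 0) :
    h =ᵐ[surfaceMeasure] 0 := by
  have hemb : MeasurableEmbedding (Subtype.val : S2 → R3) :=
    MeasurableEmbedding.subtype_coe Metric.isClosed_sphere.measurableSet
  have hfin : ∀ g : S2 → ℝ, Integrable g surfaceMeasure →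
      IsFiniteMeasure (surfaceMeasure.withDensity fun x => ENNReal.ofReal (g x)) :=
    fun g hg => isFiniteMeasure_withDensity_ofReal hg.hasFiniteIntegral
  have hchar : ∀ g : S2 → ℝ, Integrable g surfaceMeasure → ∀ ξ,
      charFun ((surfaceMeasure.withDensity fun x => ENNReal.ofReal (g x)).map Subtype.val) ξ =
      vecTransform surfaceMeasure Subtype.val (fun x => ((max (g x) 0 : ℝ) : ℂ)) (-ξ) := by
    intro g hg ξ
    rw [charFun_apply, hemb.integral_map, integral_withDensity_eq_integral_toReal_smul₀
      hg.aemeasurable.ennreal_ofReal (by simp)]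
    unfold vecTransform
    refine integral_congr_ae (Eventually.of_forall fun x => ?_)
    simp only [ENNReal.toReal_ofReal', Complex.real_smul, inner_neg_right]
    rw [mul_comm]
    push_cast
    congr 2
    ring
  have := hfin h hh
  have := hfin (fun x => -h x) hh.neg
  have heq : (surfaceMeasure.withDensity fun x => ENNReal.ofReal (h x)).map Subtype.val =
      (surfaceMeasure.withDensity fun x => ENNReal.ofReal (-h x)).map Subtype.val := by
    refine Measure.ext_of_charFun (funext fun ξ => ?_)
    rw [hchar h hh, hchar (fun x => -h x) hh.neg, ← sub_eq_zero]
    unfold vecTransform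
    rw [← integral_sub]
    · rw [← h0 (-ξ)]
      unfold vecTransform
      refine integral_congr_ae (Eventually.of_forall fun x => ?_)
      simp only
      rw [← mul_sub, ← Complex.ofReal_sub]
      congr 2
      rcases le_total (h x) 0 with h1 | h1 <;> simp [h1]
    · exact (hh.pos_part.ofReal).bdd_mul (c := 1) (by fun_prop)
        (Eventually.of_forall fun x => (norm_cexp_neg_I_mul _).le)
    · exact (hh.neg.pos_part.ofReal).bdd_mul (c := 1) (by fun_prop)
        (Eventually.of_forall fun x => (norm_cexp_neg_I_mul _).le)
  have hn : AEMeasurable (fun x => ENNReal.ofReal (-h x)) surfaceMeasure :=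
    hh.aemeasurable.neg.ennreal_ofReal
  have heq2 := congrArg (Measure.comap (Subtype.val : S2 → R3)) heq
  rw [hemb.comap_map, hemb.comap_map, withDensity_eq_iff hh.aemeasurable.ennreal_ofReal
    hn hh.lintegral_lt_top.ne] at heq2
  filter_upwards [heq2] with x hx
  have hx2 := congrArg ENNReal.toReal hx
  rw [ENNReal.toReal_ofReal', ENNReal.toReal_ofReal'] at hx2
  rcases le_total (h x) 0 with h1 | h1 <;> simp [h1] at hx2 <;> simpa using hx2

end transform

section gauss

variable {h : S2 → ℝ}

lemma integral_prod_heat_sub (hh : Integrable h surfaceMeasure) {c : ℝ} (hc : 0 < c) :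
    (2 * π) ^ 3 * ∫ q, h q.1 * h q.2 * heat c (q.1 - q.2) ∂pairMeasure =
      ∫ ξ, ‖vecTransform surfaceMeasure Subtype.val (fun x => (h x : ℂ)) ξ‖ ^ 2 *
        heatMultiplier c ξ := by
  have := integral_vecTransform_mul_conj (P := surfaceMeasure) (P' := surfaceMeasure)
    (X := Subtype.val) (X' := Subtype.val) measurable_subtype_coe measurable_subtype_coe
    hh.ofReal hh.ofReal hc
  simp only [Complex.mul_conj, Complex.conj_ofReal, Complex.normSq_eq_norm_sq,
    Complex.coe_algebraMap] at this
  norm_cast at this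
  exact this.symm

lemma abs_integral_prod_heat_add_le (hh : Integrable h surfaceMeasure) {c : ℝ} (hc : 0 < c) :
    |∫ q, h q.1 * h q.2 * heat c (q.1 + q.2) ∂pairMeasure| ≤
      ∫ q, h q.1 * h q.2 * heat c (q.1 - q.2) ∂pairMeasure := by
  have h1 := integral_vecTransform_mul_conj (P := surfaceMeasure) (P' := surfaceMeasure)
    (X := Subtype.val) (X' := fun x => -(x : R3)) measurable_subtype_coe (by fun_prop)
    hh.ofReal hh.ofReal hc
  simp only [Complex.conj_ofReal, sub_neg_eq_add, Complex.coe_algebraMap] at h1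
  norm_cast at h1
  have h3 : 0 < (2 * π) ^ 3 := by positivity
  rw [← mul_le_mul_iff_right₀ h3, integral_prod_heat_sub hh hc]
  rw [← abs_of_pos h3, ← abs_mul, ← Real.norm_eq_abs, ← Complex.norm_real]
  rw [← h1]
  refine (norm_integral_le_integral_norm _).trans_eq ?_
  refine integral_congr_ae (Eventually.of_forall fun ξ => ?_)
  have h2 : vecTransform surfaceMeasure (fun x : S2 => -(x : R3)) (fun x => (h x : ℂ)) ξ =
      starRingEnd ℂ (vecTransform surfaceMeasure Subtype.val (fun x => (h x : ℂ)) ξ) := by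
    unfold vecTransform
    rw [← integral_conj]
    refine integral_congr_ae (Eventually.of_forall fun x => ?_)
    simp [← Complex.exp_conj]
  simp only [h2, norm_mul, RCLike.norm_conj, Complex.norm_real, Real.norm_eq_abs,
    abs_of_pos (heatMultiplier_pos c ξ)]
  ring

lemma integral_prod_heat_sub_nonneg (hh : Integrable h surfaceMeasure) {c : ℝ} (hc : 0 < c) :
    0 ≤ ∫ q, h q.1 * h q.2 * heat c (q.1 - q.2) ∂pairMeasure :=
  (abs_nonneg _).trans (abs_integral_prod_heat_add_le hh hc)

lemma ae_eq_zero_of_integral_prod_heat_sub (hh : Integrable h surfaceMeasure) {c : ℝ} (hc : 0 < c)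
    (h0 : ∫ q, h q.1 * h q.2 * heat c (q.1 - q.2) ∂pairMeasure = 0) :
    h =ᵐ[surfaceMeasure] 0 := by
  have h1 := integral_prod_heat_sub hh hc
  set Z := vecTransform surfaceMeasure Subtype.val (fun x => (h x : ℂ)) with hZ
  have hZc : Continuous Z := continuous_vecTransform measurable_subtype_coe hh.ofReal
  rw [h0, mul_zero, eq_comm, integral_eq_zero_iff_of_nonneg
    (fun ξ => mul_nonneg (sq_nonneg _) (heatMultiplier_pos c ξ).le)] at h1
  · have h2 := (Continuous.ae_eq_iff_eq volume
      ((hZc.norm.pow 2).mul (continuous_heatMultiplier c)) continuous_zero).1 h1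
    refine ae_eq_zero_of_vecTransform_eq_zero hh fun ξ => ?_
    have h3 := congrFun h2 ξ
    simpa [(heatMultiplier_pos c ξ).ne'] using h3
  · refine (integrable_heatMultiplier hc).bdd_mul (c := (∫ x, ‖(h x : ℂ)‖ ∂surfaceMeasure) ^ 2)
      (hZc.norm.pow 2).aestronglyMeasurable (Eventually.of_forall fun ξ => ?_)
    rw [norm_pow, norm_norm]
    gcongr
    exact norm_vecTransform_le ξ

end gauss

/-! ### The energy and its maximizers -/

lemma integrable_mul_gaussGap {G : S2 × S2 → ℝ} (hG : Integrable G pairMeasure)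
    {X : S2 × S2 → R3} (hX : Measurable X) (h2 : ∀ q, ‖X q‖ ≤ 2) :
    Integrable (fun p : (S2 × S2) × ℝ => G p.1 * gaussGap ‖X p.1‖ p.2)
      (pairMeasure.prod volume) := by
  have hb : Integrable (fun p : (S2 × S2) × ℝ => G p.1 * (5 * (1 + p.2 ^ 2)⁻¹))
      (pairMeasure.prod volume) := hG.mul_prod (integrable_inv_one_add_sq.const_mul 5)
  refine hb.mono ?_ (Eventually.of_forall fun p => ?_)
  · refine hG.aestronglyMeasurable.comp_fst.mul ?_
    have : Measurable fun p : (S2 × S2) × ℝ => (‖X p.1‖, p.2) := by fun_prop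
    exact (measurable_gaussGap.comp this).aestronglyMeasurable
  · rw [norm_mul, norm_mul]
    refine mul_le_mul_of_nonneg_left ?_ (norm_nonneg _)
    rw [Real.norm_eq_abs, Real.norm_eq_abs, abs_of_nonneg (gaussGap_nonneg _ _),
      abs_of_nonneg (by positivity)]
    refine (gaussGap_le _ _).trans ?_
    have : ‖X p.1‖ ^ 2 ≤ 4 := by nlinarith [norm_nonneg (X p.1), h2 p.1]
    gcongr
    linarith

lemma integral_mul_norm_eq {G : S2 × S2 → ℝ} (hG : Integrable G pairMeasure)
    {X : S2 × S2 → R3} (hX : Measurable X) (h2 : ∀ q, ‖X q‖ ≤ 2) :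
    (∫ u, gaussGap 1 u) * ∫ q, G q * ‖X q‖ ∂pairMeasure =
      ∫ u, ∫ q, G q * gaussGap ‖X q‖ u ∂pairMeasure := by
  rw [← integral_integral_swap (integrable_mul_gaussGap hG hX h2), ← integral_const_mul]
  refine integral_congr_ae (Eventually.of_forall fun q => ?_)
  simp only
  rw [integral_const_mul, integral_gaussGap (norm_nonneg _)]
  ring

lemma integral_mul_gaussGap_eq {G : S2 × S2 → ℝ} (hG : Integrable G pairMeasure)
    (hG0 : ∫ q, G q ∂pairMeasure = 0) {X : S2 × S2 → R3} (hX : Measurable X) {u : ℝ}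
    (hu : u ≠ 0) :
    ∫ q, G q * gaussGap ‖X q‖ u ∂pairMeasure =
      -((u ^ 2)⁻¹ * (√(π * (u ^ 2 / π ^ 2)) ^ 3)⁻¹ *
        ∫ q, G q * heat (u ^ 2 / π ^ 2) (X q) ∂pairMeasure) := by
  have hs : √(π * (u ^ 2 / π ^ 2)) ^ 3 ≠ 0 := by positivity
  have hc : 0 < u ^ 2 / π ^ 2 := by positivity
  have h1 : ∀ q, G q * gaussGap ‖X q‖ u = (u ^ 2)⁻¹ * G q -
      ((u ^ 2)⁻¹ * (√(π * (u ^ 2 / π ^ 2)) ^ 3)⁻¹) * (G q * heat (u ^ 2 / π ^ 2) (X q)) := by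
    intro q
    unfold gaussGap heat
    have : -π ^ 2 * (u ^ 2 / π ^ 2) * ‖X q‖ ^ 2 = -(‖X q‖ ^ 2 * u ^ 2) := by
      field_simp
    rw [this]
    field_simp
  have hi : Integrable (fun q => G q * heat (u ^ 2 / π ^ 2) (X q)) pairMeasure :=
    hG.mul_bdd (c := √(π * (u ^ 2 / π ^ 2)) ^ 3)
      ((continuous_heat _).measurable.comp hX).aestronglyMeasurable
      (Eventually.of_forall fun p => abs_heat_le hc _)
  simp_rw [h1]
  rw [integral_sub (hG.const_mul _) (hi.const_mul _), integral_const_mul, integral_const_mul, hG0]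
  ring

section energy

variable {h : S2 → ℝ}

/-- The Gaussian slices of the energy. -/
noncomputable def energySlice (h : S2 → ℝ) (u : ℝ) : ℝ :=
  2 * ∫ q, h q.1 * h q.2 * gaussGap ‖(q.1 + q.2 : R3)‖ u ∂pairMeasure +
    4 * ∫ q, h q.1 * h q.2 * gaussGap ‖(q.1 - q.2 : R3)‖ u ∂pairMeasure

lemma integral_energySlice (hh : Integrable h surfaceMeasure) :
    Integrable (energySlice h) ∧
      ∫ u, energySlice h u = (∫ u, gaussGap 1 u) * energy h := by
  have hG : Integrable (fun q : S2 × S2 => h q.1 * h q.2) pairMeasure := hh.mul_prod hh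
  have h1 := (integrable_mul_gaussGap hG (X := fun q => (q.1 + q.2 : R3)) (by fun_prop)
    fun q => norm_add_S2_le _ _).integral_prod_right
  have h2 := (integrable_mul_gaussGap hG (X := fun q => (q.1 - q.2 : R3)) (by fun_prop)
    fun q => norm_sub_S2_le _ _).integral_prod_right
  refine ⟨(h1.const_mul 2).add (h2.const_mul 4), ?_⟩
  unfold energySlice
  rw [integral_add (h1.const_mul 2) (h2.const_mul 4), integral_const_mul, integral_const_mul]
  have e1 := integral_mul_norm_eq hG (X := fun q => (q.1 + q.2 : R3)) (by fun_prop)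
    fun q => norm_add_S2_le _ _
  have e2 := integral_mul_norm_eq hG (X := fun q => (q.1 - q.2 : R3)) (by fun_prop)
    fun q => norm_sub_S2_le _ _
  rw [← e1, ← e2]
  unfold energy
  ring

lemma energySlice_le (hh : Integrable h surfaceMeasure) (h0 : ∫ x, h x ∂surfaceMeasure = 0)
    {u : ℝ} (hu : u ≠ 0) :
    energySlice h u ≤ -(2 * ((u ^ 2)⁻¹ * (√(π * (u ^ 2 / π ^ 2)) ^ 3)⁻¹ *
      ∫ q, h q.1 * h q.2 * heat (u ^ 2 / π ^ 2) (q.1 - q.2) ∂pairMeasure)) := by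
  have hG : Integrable (fun q : S2 × S2 => h q.1 * h q.2) pairMeasure := hh.mul_prod hh
  have hG0 : ∫ q, h q.1 * h q.2 ∂pairMeasure = 0 := by
    rw [integral_prod_mul, h0, zero_mul]
  have e1 := integral_mul_gaussGap_eq hG hG0 (X := fun q => (q.1 + q.2 : R3)) (by fun_prop) hu
  have e2 := integral_mul_gaussGap_eq hG hG0 (X := fun q => (q.1 - q.2 : R3)) (by fun_prop) hu
  unfold energySlice
  rw [e1, e2]
  have h1 := (abs_le.1 (abs_integral_prod_heat_add_le hh (c := u ^ 2 / π ^ 2) (by positivity))).1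
  have h2 := mul_le_mul_of_nonneg_left h1
    (show 0 ≤ (u ^ 2)⁻¹ * (√(π * (u ^ 2 / π ^ 2)) ^ 3)⁻¹ by positivity)
  linarith

lemma energySlice_nonpos (hh : Integrable h surfaceMeasure) (h0 : ∫ x, h x ∂surfaceMeasure = 0)
    (u : ℝ) : energySlice h u ≤ 0 := by
  by_cases hu : u = 0
  · simp [hu, energySlice, gaussGap]
  · refine (energySlice_le hh h0 hu).trans ?_
    have := integral_prod_heat_sub_nonneg hh (c := u ^ 2 / π ^ 2) (by positivity)
    rw [neg_nonpos]
    positivity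

/-- The energy is negative semidefinite on functions of mean zero. -/
lemma energy_nonpos (hh : Integrable h surfaceMeasure) (h0 : ∫ x, h x ∂surfaceMeasure = 0) :
    energy h ≤ 0 := by
  have h1 : ∫ u, energySlice h u ≤ 0 := integral_nonpos (energySlice_nonpos hh h0)
  rw [(integral_energySlice hh).2] at h1
  exact nonpos_of_mul_nonpos_right h1 integral_gaussGap_one_pos

/-- The energy is negative definite on functions of mean zero. -/
lemma ae_eq_zero_of_energy_eq_zero (hh : Integrable h surfaceMeasure)
    (h0 : ∫ x, h x ∂surfaceMeasure = 0) (he : energy h = 0) : h =ᵐ[surfaceMeasure] 0 := by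
  obtain ⟨hi, h1⟩ := integral_energySlice hh
  rw [he, mul_zero, ← neg_eq_zero, ← integral_neg,
    integral_eq_zero_iff_of_nonneg (fun u => neg_nonneg.2 (energySlice_nonpos hh h0 u)) hi.neg] at h1
  obtain ⟨u, hu, hu0⟩ := (h1.and (Measure.ae_ne volume (0 : ℝ))).exists
  have h2 := energySlice_le hh h0 hu0
  have h3 : energySlice h u = 0 := by simpa using hu
  have h4 := integral_prod_heat_sub_nonneg hh (c := u ^ 2 / π ^ 2) (by positivity)
  refine ae_eq_zero_of_integral_prod_heat_sub hh (c := u ^ 2 / π ^ 2) (by positivity) ?_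
  refine le_antisymm ?_ h4
  have h5 : 0 < (u ^ 2)⁻¹ * (√(π * (u ^ 2 / π ^ 2)) ^ 3)⁻¹ := by positivity
  rw [h3] at h2
  by_contra hlt
  have := mul_pos h5 (not_le.1 hlt)
  linarith

end energy

section invariance

variable {Φ : R3 → ℝ}

lemma exists_isometry_S2 (x x' : S2) : ∃ U : R3 ≃ₗᵢ[ℝ] R3, U x = x' :=
  ⟨(ℝ ∙ ((x : R3) - x'))ᗮ.reflection, Submodule.reflection_sub (by simp)⟩

lemma integral_comp_add_eq (hΦ : Measurable Φ) (hU : ∀ (U : R3 ≃ₗᵢ[ℝ] R3) v, Φ (U v) = Φ v)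
    (x x' : S2) :
    ∫ y : S2, Φ (x + y) ∂surfaceMeasure = ∫ y : S2, Φ (x' + y) ∂surfaceMeasure := by
  obtain ⟨U, hx⟩ := exists_isometry_S2 x x'
  rw [← integral_sphere_comp_isometry U (F := fun y => Φ (x' + y)) (by fun_prop)]
  refine integral_congr_ae (Eventually.of_forall fun y => ?_)
  simp only
  rw [← hx, ← map_add, hU]

lemma integral_comp_sub_eq (hΦ : Measurable Φ) (hU : ∀ (U : R3 ≃ₗᵢ[ℝ] R3) v, Φ (U v) = Φ v)
    (x x' : S2) :
    ∫ y : S2, Φ (x - y) ∂surfaceMeasure = ∫ y : S2, Φ (x' - y) ∂surfaceMeasure := by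
  obtain ⟨U, hx⟩ := exists_isometry_S2 x x'
  rw [← integral_sphere_comp_isometry U (F := fun y => Φ (x' - y)) (by fun_prop)]
  refine integral_congr_ae (Eventually.of_forall fun y => ?_)
  simp only
  rw [← hx, ← map_sub, hU]

end invariance

section mean

variable {h : S2 → ℝ}

lemma integral_fst_mul_eq_zero (h0 : ∫ x, h x ∂surfaceMeasure = 0) {K : S2 × S2 → ℝ}
    (hi : Integrable (fun q : S2 × S2 => h q.1 * K q) pairMeasure)
    (hK : ∀ x x', ∫ y, K (x, y) ∂surfaceMeasure = ∫ y, K (x', y) ∂surfaceMeasure) :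
    ∫ q, h q.1 * K q ∂pairMeasure = 0 := by
  rw [integral_prod _ hi]
  simp_rw [integral_const_mul]
  have x₀ : S2 := ⟨EuclideanSpace.single 0 1, by simp⟩
  simp_rw [fun x => hK x x₀]
  rw [integral_mul_const, h0, zero_mul]

lemma integrable_mul_norm {G : S2 × S2 → ℝ} (hG : Integrable G pairMeasure)
    {X : S2 × S2 → R3} (hX : Measurable X) (h2 : ∀ q, ‖X q‖ ≤ 2) :
    Integrable (fun q => G q * ‖X q‖) pairMeasure :=
  hG.mul_bdd (c := 2) (by fun_prop) (Eventually.of_forall fun q => by simpa using h2 q)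

lemma integral_const_add_mul_norm (hh : Integrable h surfaceMeasure)
    (h0 : ∫ x, h x ∂surfaceMeasure = 0) (m : ℝ) {X : S2 × S2 → R3} (hX : Measurable X)
    (h2 : ∀ q, ‖X q‖ ≤ 2) (hs : ∀ q, ‖X q.swap‖ = ‖X q‖)
    (hK : ∀ x x', ∫ y, ‖X (x, y)‖ ∂surfaceMeasure = ∫ y, ‖X (x', y)‖ ∂surfaceMeasure) :
    ∫ q, (m + h q.1) * (m + h q.2) * ‖X q‖ ∂pairMeasure =
      m ^ 2 * (∫ q, 1 * 1 * ‖X q‖ ∂pairMeasure) +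
        ∫ q, h q.1 * h q.2 * ‖X q‖ ∂pairMeasure := by
  have i1 := integrable_mul_norm (integrable_const (μ := pairMeasure) (1 : ℝ)) hX h2
  have i2 := integrable_mul_norm (hh.comp_fst surfaceMeasure) hX h2
  have i3 := integrable_mul_norm (hh.comp_snd surfaceMeasure) hX h2
  have i4 := integrable_mul_norm (hh.mul_prod hh) hX h2
  have e2 : ∫ q, h q.1 * ‖X q‖ ∂pairMeasure = 0 := integral_fst_mul_eq_zero h0 i2 hK
  have e3 : ∫ q, h q.2 * ‖X q‖ ∂pairMeasure = 0 := by
    rw [← e2, ← integral_prod_swap]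
    simp only [Prod.snd_swap, hs]
  have : ∀ q : S2 × S2, (m + h q.1) * (m + h q.2) * ‖X q‖ = m ^ 2 * (1 * ‖X q‖) +
      m * (h q.1 * ‖X q‖) + m * (h q.2 * ‖X q‖) + h q.1 * h q.2 * ‖X q‖ := fun q => by ring
  simp_rw [this]
  have j1 : Integrable (fun q => m ^ 2 * (1 * ‖X q‖) + m * (h q.1 * ‖X q‖)) pairMeasure :=
    (i1.const_mul _).add (i2.const_mul _)
  have j2 : Integrable (fun q => m ^ 2 * (1 * ‖X q‖) + m * (h q.1 * ‖X q‖) +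
    m * (h q.2 * ‖X q‖)) pairMeasure := j1.add (i3.const_mul _)
  rw [integral_add j2 i4, integral_add j1 (i3.const_mul _),
    integral_add (i1.const_mul _) (i2.const_mul _)]
  simp only [integral_const_mul, e2, e3]
  ring

lemma energy_const_add (hh : Integrable h surfaceMeasure) (h0 : ∫ x, h x ∂surfaceMeasure = 0)
    (m : ℝ) : energy (fun x => m + h x) = m ^ 2 * energy (fun _ => 1) + energy h := by
  have e1 := integral_const_add_mul_norm hh h0 m (X := fun q => (q.1 + q.2 : R3)) (by fun_prop)
    (fun q => norm_add_S2_le _ _) (fun q => by simp [add_comm])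
    (integral_comp_add_eq (Φ := norm) (by fun_prop) fun U v => by simp)
  have e2 := integral_const_add_mul_norm hh h0 m (X := fun q => (q.1 - q.2 : R3)) (by fun_prop)
    (fun q => norm_sub_S2_le _ _) (fun q => by simp [norm_sub_rev])
    (integral_comp_sub_eq (Φ := norm) (by fun_prop) fun U v => by simp)
  unfold energy
  rw [e1, e2]
  ring

/-- The constants maximize the energy at a given mean. -/
lemma energy_le {g : S2 → ℝ} (hg : Integrable g surfaceMeasure) :
    energy g ≤ ((4 * π)⁻¹ * ∫ x, g x ∂surfaceMeasure) ^ 2 * energy (fun _ => 1) ∧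
      (energy g = ((4 * π)⁻¹ * ∫ x, g x ∂surfaceMeasure) ^ 2 * energy (fun _ => 1) →
        ∀ᵐ x ∂surfaceMeasure, g x = (4 * π)⁻¹ * ∫ x, g x ∂surfaceMeasure) := by
  set m := (4 * π)⁻¹ * ∫ x, g x ∂surfaceMeasure with hm
  have hi : Integrable (fun x => g x - m) surfaceMeasure := hg.sub (integrable_const m)
  have h0 : ∫ x, (g x - m) ∂surfaceMeasure = 0 := by
    rw [integral_sub hg (integrable_const m), integral_const, surfaceMeasure_real_univ, smul_eq_mul,
      hm]
    field_simp
    ring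
  have h1 := energy_const_add hi h0 m
  simp only [add_sub_cancel] at h1
  refine ⟨by linarith [energy_nonpos hi h0], fun he => ?_⟩
  filter_upwards [ae_eq_zero_of_energy_eq_zero hi h0 (by linarith)] with x hx
  exact sub_eq_zero.1 hx

lemma energy_one_pos : 0 < energy fun _ => 1 := by
  have i1 := integrable_mul_norm (integrable_const (μ := pairMeasure) (1 : ℝ))
    (X := fun q => (q.1 + q.2 : R3)) (by fun_prop) (fun q => norm_add_S2_le _ _)
  have i2 := integrable_mul_norm (integrable_const (μ := pairMeasure) (1 : ℝ))
    (X := fun q => (q.1 - q.2 : R3)) (by fun_prop) (fun q => norm_sub_S2_le _ _)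
  unfold energy
  simp only [one_mul] at i1 i2 ⊢
  rw [← integral_const_mul, ← integral_const_mul, ← integral_add (i1.const_mul 2) (i2.const_mul 4)]
  have h : ∀ q : S2 × S2, (4 : ℝ) ≤ 2 * ‖(q.1 + q.2 : R3)‖ + 4 * ‖(q.1 - q.2 : R3)‖ := by
    intro q
    have h1 := parallelogram_law_with_norm ℝ (q.1 : R3) q.2
    simp only [norm_S2] at h1
    have h2 := norm_add_S2_le q.1 q.2
    have h3 := norm_sub_S2_le q.1 q.2
    nlinarith [norm_nonneg (q.1 + q.2 : R3), norm_nonneg (q.1 - q.2 : R3)]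
  have h2 := integral_mono (integrable_const (μ := pairMeasure) (4 : ℝ))
    ((i1.const_mul 2).add (i2.const_mul 4)) h
  refine lt_of_lt_of_le ?_ h2
  rw [integral_const, ← univ_prod_univ, measureReal_prod_prod, surfaceMeasure_real_univ, smul_eq_mul]
  positivity

end mean

/-! ### The extension inequality -/

section transform

variable {f : S2 → ℂ}

/-- The regularized fourth power `∫ |(fσ)^|⁴ e^{-|ξ|²/(4π²c)}`. -/
noncomputable def fourthPower (c : ℝ) (f : S2 → ℂ) : ℝ :=
  ∫ ξ, ‖fourierSphere f ξ‖ ^ 4 * heatMultiplier c ξ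

lemma fourthPower_eq (hf : Integrable f surfaceMeasure) {c : ℝ} (hc : 0 < c) :
    (fourthPower c f : ℂ) = (2 * π : ℂ) ^ 3 * ∫ p, (f p.1.1 * f p.1.2) *
      starRingEnd ℂ (f p.2.1 * f p.2.2) * (heat c (defect p) : ℂ) ∂quadMeasure := by
  have hff : Integrable (fun q : S2 × S2 => f q.1 * f q.2) pairMeasure := hf.mul_prod hf
  have h := integral_vecTransform_mul_conj (P := pairMeasure) (P' := pairMeasure)
    (X := fun q : S2 × S2 => (q.1 + q.2 : R3)) (X' := fun q : S2 × S2 => (q.1 + q.2 : R3))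
    (by fun_prop) (by fun_prop) hff hff hc
  refine Eq.trans ?_ h
  unfold fourthPower
  rw [← integral_complex_ofReal]
  refine integral_congr_ae (Eventually.of_forall fun ξ => ?_)
  have hsq : vecTransform pairMeasure (fun q : S2 × S2 => (q.1 + q.2 : R3))
      (fun q => f q.1 * f q.2) ξ = fourierSphere f ξ ^ 2 := by
    unfold vecTransform fourierSphere
    rw [sq, ← integral_prod_mul]
    refine integral_congr_ae (Eventually.of_forall fun q => ?_)
    simp only [inner_add_left, Complex.ofReal_add, mul_add, Complex.exp_add]
    ring
  simp only [hsq]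
  rw [Complex.mul_conj, Complex.normSq_eq_norm_sq, norm_pow]
  push_cast
  ring

lemma fourthPower_le (hf : MemLp f 2 surfaceMeasure) {c : ℝ} (hc : 0 < c) :
    fourthPower c f ≤ (2 * π) ^ 3 * quadForm c fun x => ‖f x‖ := by
  have h := congrArg norm (fourthPower_eq (hf.integrable (by norm_num)) hc)
  rw [norm_mul, Complex.norm_real] at h
  refine (le_abs_self _).trans ?_
  rw [← Real.norm_eq_abs, h]
  have : ‖(2 * π : ℂ) ^ 3‖ = (2 * π) ^ 3 := by
    rw [norm_pow, norm_mul, Complex.norm_real, Complex.norm_ofNat, Real.norm_eq_abs,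
      abs_of_pos pi_pos]
  rw [this]
  refine mul_le_mul_of_nonneg_left ((norm_integral_le_integral_norm _).trans_eq ?_) (by positivity)
  unfold quadForm prodFour
  refine integral_congr_ae (Eventually.of_forall fun p => ?_)
  simp only [norm_mul, RCLike.norm_conj, Complex.norm_real, Real.norm_eq_abs,
    abs_of_nonneg (heat_nonneg _ _)]

lemma fourthPower_ofReal {s : S2 → ℝ} (hs : Integrable s surfaceMeasure) {c : ℝ} (hc : 0 < c) :
    fourthPower c (fun x => (s x : ℂ)) = (2 * π) ^ 3 * quadForm c s := by
  have h := fourthPower_eq hs.ofReal hc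
  simp only [Complex.coe_algebraMap, map_mul, Complex.conj_ofReal] at h
  norm_cast at h

lemma heatMultiplier_mono {c c' : ℝ} (hc : 0 < c) (h : c ≤ c') (ξ : R3) :
    heatMultiplier c ξ ≤ heatMultiplier c' ξ := by
  unfold heatMultiplier
  refine exp_le_exp.2 ?_
  rw [neg_mul, neg_mul, neg_le_neg_iff]
  gcongr

lemma tendsto_heatMultiplier (ξ : R3) :
    Tendsto (fun n : ℕ => heatMultiplier (n + 1) ξ) atTop (𝓝 1) := by
  unfold heatMultiplier
  have h1 : Tendsto (fun n : ℕ => (4 * π ^ 2 * ((n : ℝ) + 1))⁻¹) atTop (𝓝 0) :=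
    Tendsto.inv_tendsto_atTop ((tendsto_natCast_atTop_atTop.atTop_add tendsto_const_nhds).const_mul_atTop
      (by positivity))
  have h2 := (h1.neg.mul_const (‖ξ‖ ^ 2)).rexp
  simpa using h2

lemma integrable_fourthPower (hf : Integrable f surfaceMeasure) {c : ℝ} (hc : 0 < c) :
    Integrable fun ξ => ‖fourierSphere f ξ‖ ^ 4 * heatMultiplier c ξ := by
  have hcont := continuous_vecTransform measurable_subtype_coe hf
  refine (integrable_heatMultiplier hc).bdd_mul (c := (∫ x, ‖f x‖ ∂surfaceMeasure) ^ 4)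
    (hcont.norm.pow 4).aestronglyMeasurable (Eventually.of_forall fun ξ => ?_)
  rw [norm_pow, norm_norm]
  gcongr
  exact norm_vecTransform_le ξ

/-- The regularized fourth powers increase to `‖(fσ)^‖₄⁴`. -/
lemma tendsto_fourthPower (hf : Integrable f surfaceMeasure) :
    Tendsto (fun n : ℕ => ENNReal.ofReal (fourthPower (n + 1) f)) atTop
      (𝓝 (eLpNorm (fourierSphere f) 4 (volume : Measure R3) ^ 4)) := by
  have hcont : Continuous (fourierSphere f) := continuous_vecTransform measurable_subtype_coe hf
  have h4 : eLpNorm (fourierSphere f) 4 (volume : Measure R3) ^ 4 =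
      ∫⁻ ξ, ENNReal.ofReal (‖fourierSphere f ξ‖ ^ 4) := by
    have := eLpNorm_nnreal_pow_eq_lintegral (f := fourierSphere f) (μ := (volume : Measure R3))
      (p := 4) (by norm_num)
    simp only [NNReal.coe_ofNat, ENNReal.coe_ofNat, ENNReal.rpow_ofNat] at this
    rw [this]
    refine lintegral_congr fun ξ => ?_
    rw [ENNReal.ofReal_pow (norm_nonneg _), ofReal_norm]
  rw [h4]
  have h5 : ∀ n : ℕ, ENNReal.ofReal (fourthPower (n + 1) f) =
      ∫⁻ ξ, ENNReal.ofReal (‖fourierSphere f ξ‖ ^ 4 * heatMultiplier (n + 1) ξ) := fun n =>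
    ofReal_integral_eq_lintegral_ofReal (integrable_fourthPower hf (by positivity))
      (Eventually.of_forall fun ξ => mul_nonneg (by positivity) (heatMultiplier_pos _ ξ).le)
  simp_rw [h5]
  refine lintegral_tendsto_of_tendsto_of_monotone (fun n => ?_) ?_ ?_
  · exact (((hcont.norm.pow 4).mul (continuous_heatMultiplier _)).measurable.ennreal_ofReal).aemeasurable
  · refine Eventually.of_forall fun ξ n m hnm => ENNReal.ofReal_le_ofReal ?_
    refine mul_le_mul_of_nonneg_left (heatMultiplier_mono (by positivity) ?_ ξ) (by positivity)
    have : (n : ℝ) ≤ m := by exact_mod_cast hnm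
    linarith
  · refine Eventually.of_forall fun ξ => ENNReal.tendsto_ofReal ?_
    simpa using (tendsto_heatMultiplier ξ).const_mul (‖fourierSphere f ξ‖ ^ 4)

lemma tendsto_natCast_add_one : Tendsto (fun n : ℕ => (n : ℝ) + 1) atTop atTop :=
  tendsto_natCast_atTop_atTop.atTop_add tendsto_const_nhds

/-- The extension inequality: `‖(fσ)^‖₄⁴` is at most `2π⁴` times the energy of `|f|²`. -/
lemma eLpNorm_fourierSphere_le (hf : MemLp f 2 surfaceMeasure) :
    eLpNorm (fourierSphere f) 4 (volume : Measure R3) ^ 4 ≤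
      ENNReal.ofReal (2 * π ^ 4 * energy fun x => ‖f x‖ ^ 2) := by
  obtain ⟨U, hU, hle⟩ := exists_tendsto_quadForm_le hf.norm fun x => norm_nonneg _
  have h1 := ENNReal.tendsto_ofReal ((hU.comp tendsto_natCast_add_one).const_mul ((2 * π) ^ 3))
  rw [show (2 * π) ^ 3 * (π / 4 * energy fun x => ‖f x‖ ^ 2) =
    2 * π ^ 4 * energy fun x => ‖f x‖ ^ 2 by ring] at h1
  refine le_of_tendsto_of_tendsto' (tendsto_fourthPower (hf.integrable (by norm_num))) h1 fun n => ?_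
  refine ENNReal.ofReal_le_ofReal ((fourthPower_le hf (by positivity)).trans ?_)
  exact mul_le_mul_of_nonneg_left (hle _ (by positivity)) (by positivity)

lemma eLpNorm_fourierSphere_one :
    eLpNorm (fourierSphere fun _ => 1) 4 (volume : Measure R3) ^ 4 =
      ENNReal.ofReal (2 * π ^ 4 * energy fun _ => 1) := by
  have hi : Integrable (fun _ : S2 => (1 : ℝ)) surfaceMeasure := integrable_const 1
  have h1 := ENNReal.tendsto_ofReal ((tendsto_quadForm_one.comp tendsto_natCast_add_one).const_mul
    ((2 * π) ^ 3))
  rw [show (2 * π) ^ 3 * (π / 4 * energy fun _ => 1) = 2 * π ^ 4 * energy fun _ => 1 by ring] at h1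
  refine tendsto_nhds_unique (tendsto_fourthPower (integrable_const 1)) (h1.congr fun n => ?_)
  congr 1
  have := fourthPower_ofReal hi (c := n + 1) (by positivity)
  simp only [Complex.ofReal_one] at this
  exact this.symm

end transform

/-! ### Convolutions of the singular part of the density -/

/-- The cutoff to the region where the density of `σ * σ` exceeds `N`. -/
noncomputable def highPart (N : ℝ) (w : R3) : ℝ := if N < convDensity w then 1 else 0

lemma convDensity_isometry (U : R3 ≃ₗᵢ[ℝ] R3) (v : R3) : convDensity (U v) = convDensity v := by
  simp [convDensity]

lemma highPart_nonneg (N : ℝ) (w : R3) : 0 ≤ highPart N w := by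
  unfold highPart; split_ifs <;> norm_num

lemma highPart_le_one (N : ℝ) (w : R3) : highPart N w ≤ 1 := by
  unfold highPart; split_ifs <;> norm_num

@[fun_prop]
lemma measurable_highPart (N : ℝ) : Measurable (highPart N) :=
  Measurable.ite (measurableSet_lt measurable_const measurable_convDensity) (by fun_prop)
    (by fun_prop)

lemma convMoll_isometry {W : R3 → ℝ} {c : ℝ} (hU : ∀ (U : R3 ≃ₗᵢ[ℝ] R3) v, W (U v) = W v)
    (U : R3 ≃ₗᵢ[ℝ] R3) (v : R3) : convMoll W c (U v) = convMoll W c v := by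
  unfold convMoll
  rw [← U.measurePreserving.integral_comp U.toHomeomorph.measurableEmbedding]
  refine integral_congr_ae (Eventually.of_forall fun w => ?_)
  simp only [convDensity_isometry, hU]
  congr 2
  unfold heat
  rw [← map_sub, LinearIsometryEquiv.norm_map]

section cutoff

variable {W : R3 → ℝ} {c : ℝ}

lemma integrable_convMoll (hc : 0 < c) (hW : Measurable W) (h1 : ∀ w, |W w| ≤ 1) (v : R3) :
    Integrable fun w => convDensity w * (W w * heat c (v - w)) := by
  have := (continuous_heat c).measurable
  refine integrable_convDensity.mul_bdd (c := 1 * √(π * c) ^ 3) (by fun_prop)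
    (Eventually.of_forall fun w => ?_)
  rw [norm_mul]
  exact mul_le_mul (h1 w) (abs_heat_le hc _) (norm_nonneg _) zero_le_one

lemma convMoll_le_add (hc : 0 < c) {N : ℝ} (hN : 0 ≤ N) (v : R3) :
    convMoll (fun _ => 1) c v ≤ N + convMoll (highPart N) c v := by
  have hh : ∀ w, |highPart N w| ≤ 1 := fun w => by
    rw [abs_of_nonneg (highPart_nonneg N w)]; exact highPart_le_one N w
  have i1 := integrable_convMoll hc (measurable_highPart N) hh v
  have i2 := (integrable_heat_sub hc v).const_mul N
  have h : N = ∫ w, N * heat c (v - w) := by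
    rw [integral_const_mul, integral_heat_sub hc, mul_one]
  nth_rw 1 [h]
  unfold convMoll
  rw [← integral_add i2 i1]
  refine integral_mono (integrable_convMoll hc (by fun_prop) (by simp) v) (i2.add i1) fun w => ?_
  have h0 := heat_nonneg c (v - w)
  have hk := convDensity_nonneg w
  simp only [highPart]
  split_ifs with hw
  · have : 0 ≤ N * heat c (v - w) := by positivity
    linarith
  · have := mul_le_mul_of_nonneg_right (not_lt.1 hw) h0
    linarith

lemma integral_heat_mul_convDensity_le (hc : 0 < c) {N : ℝ} {t : ℝ} (ht : 0 < t) :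
    ∫ v, convDensity v * convMoll (highPart N) c v ≤
      (t * ∫ w, convDensity w ^ 2 * highPart N w) / 2 + (t⁻¹ * ∫ w, convDensity w ^ 2) / 2 := by
  have hkh : Integrable fun w => convDensity w ^ 2 * highPart N w := by
    refine integrable_convDensity_sq.mul_bdd (c := 1) (by fun_prop)
      (Eventually.of_forall fun w => ?_)
    rw [Real.norm_eq_abs, abs_of_nonneg (highPart_nonneg N w)]
    exact highPart_le_one N w
  have hH := integrable_heat hc
  -- the two Gaussian convolutions of the squares
  have i1 : Integrable (fun p : R3 × R3 => convDensity p.2 ^ 2 * highPart N p.2 * heat c (p.1 - p.2))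
      (volume.prod volume) := by
    simpa using hkh.convolution_integrand (ContinuousLinearMap.mul ℝ ℝ) hH
  have i2 : Integrable (fun p : R3 × R3 => convDensity p.2 ^ 2 * heat c (p.1 - p.2))
      (volume.prod volume) := by
    simpa using integrable_convDensity_sq.convolution_integrand (ContinuousLinearMap.mul ℝ ℝ) hH
  have i2' : Integrable (fun p : R3 × R3 => convDensity p.1 ^ 2 * heat c (p.1 - p.2))
      (volume.prod volume) := by
    refine i2.swap.congr (Eventually.of_forall fun p => ?_)
    simp [heat_sub_comm c p.2 p.1]
  have e1 : ∫ p : R3 × R3, convDensity p.2 ^ 2 * highPart N p.2 * heat c (p.1 - p.2)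
      ∂(volume.prod volume) = ∫ w, convDensity w ^ 2 * highPart N w := by
    rw [integral_prod_symm _ i1]
    refine integral_congr_ae (Eventually.of_forall fun w => ?_)
    simp only
    rw [integral_const_mul]
    simp_rw [heat_sub_comm c _ w]
    rw [integral_heat_sub hc, mul_one]
  have e2 : ∫ p : R3 × R3, convDensity p.1 ^ 2 * heat c (p.1 - p.2)
      ∂(volume.prod volume) = ∫ w, convDensity w ^ 2 := by
    rw [integral_prod _ i2']
    refine integral_congr_ae (Eventually.of_forall fun w => ?_)
    simp only
    rw [integral_const_mul, integral_heat_sub hc, mul_one]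
  have i3 := ((i1.const_mul t).div_const 2).add ((i2'.const_mul t⁻¹).div_const 2)
  have hle : ∀ p : R3 × R3, convDensity p.1 * (convDensity p.2 * (highPart N p.2 *
      heat c (p.1 - p.2))) ≤ t * (convDensity p.2 ^ 2 * highPart N p.2 * heat c (p.1 - p.2)) / 2 +
      t⁻¹ * (convDensity p.1 ^ 2 * heat c (p.1 - p.2)) / 2 := by
    intro p
    have h0 := heat_nonneg c (p.1 - p.2)
    unfold highPart
    split_ifs
    · have hy : 0 ≤ t * (convDensity p.2 - t⁻¹ * convDensity p.1) ^ 2 := by positivity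
      have hy2 : t * (convDensity p.2 - t⁻¹ * convDensity p.1) ^ 2 =
          t * convDensity p.2 ^ 2 + t⁻¹ * convDensity p.1 ^ 2 -
            2 * (convDensity p.1 * convDensity p.2) := by
        field_simp
        ring
      rw [hy2] at hy
      have := mul_nonneg hy h0
      linarith
    · have : 0 ≤ t⁻¹ * (convDensity p.1 ^ 2 * heat c (p.1 - p.2)) / 2 := by positivity
      simpa using this
  have i4 : Integrable (fun p : R3 × R3 => convDensity p.1 * (convDensity p.2 * (highPart N p.2 *
      heat c (p.1 - p.2)))) (volume.prod volume) := by
    refine i3.mono' ?_ (Eventually.of_forall fun p => ?_)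
    · have := (continuous_heat c).measurable
      fun_prop
    · have h1 := convDensity_nonneg p.1
      have h2 := convDensity_nonneg p.2
      have h3 := heat_nonneg c (p.1 - p.2)
      have h4 := highPart_nonneg N p.2
      rw [Real.norm_eq_abs, abs_of_nonneg (by positivity)]
      exact hle p
  calc ∫ v, convDensity v * convMoll (highPart N) c v
      = ∫ p : R3 × R3, convDensity p.1 * (convDensity p.2 * (highPart N p.2 *
          heat c (p.1 - p.2))) ∂(volume.prod volume) := by
        rw [integral_prod _ i4]
        refine integral_congr_ae (Eventually.of_forall fun v => ?_)
        simp only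
        rw [integral_const_mul]
        rfl
    _ ≤ ∫ p : R3 × R3, (t * (convDensity p.2 ^ 2 * highPart N p.2 * heat c (p.1 - p.2)) / 2 +
      t⁻¹ * (convDensity p.1 ^ 2 * heat c (p.1 - p.2)) / 2) ∂(volume.prod volume) :=
        integral_mono i4 i3 hle
    _ = _ := by
        rw [integral_add ((i1.const_mul t).div_const 2) ((i2'.const_mul t⁻¹).div_const 2),
          integral_div, integral_div, integral_const_mul, integral_const_mul, e1, e2]

lemma tendsto_integral_highPart :
    Tendsto (fun N : ℕ => ∫ w, convDensity w ^ 2 * highPart N w) atTop (𝓝 0) := by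
  rw [← integral_zero R3 ℝ]
  refine tendsto_integral_of_dominated_convergence (fun w => convDensity w ^ 2)
    (fun N => by fun_prop) integrable_convDensity_sq (fun N => Eventually.of_forall fun w => ?_)
    (Eventually.of_forall fun w => ?_)
  · have := highPart_nonneg N w
    rw [Real.norm_eq_abs, abs_of_nonneg (by positivity)]
    exact mul_le_of_le_one_right (sq_nonneg _) (highPart_le_one _ _)
  · obtain ⟨M, hM⟩ := exists_nat_ge (convDensity w)
    refine tendsto_const_nhds.congr' ?_
    filter_upwards [eventually_ge_atTop M] with N hN
    have : convDensity w ≤ N := hM.trans (by exact_mod_cast hN)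
    simp [highPart, not_lt.2 this]

end cutoff

/-! ### Changes of sign on a small set -/

section parity

variable {W : R3 → ℝ} {c : ℝ} {E : Set S2}

lemma abs_convMoll_le (hc : 0 < c) (h1 : ∀ w, |W w| ≤ 1) (v : R3) :
    |convMoll W c v| ≤ ∫ w, convDensity w * (1 * √(π * c) ^ 3) := by
  unfold convMoll
  rw [← Real.norm_eq_abs]
  refine norm_integral_le_of_norm_le (integrable_convDensity.mul_const _)
    (Eventually.of_forall fun w => ?_)
  rw [norm_mul, norm_mul, Real.norm_eq_abs, abs_of_nonneg (convDensity_nonneg w)]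
  exact mul_le_mul_of_nonneg_left
    (mul_le_mul (h1 w) (abs_heat_le hc _) (norm_nonneg _) zero_le_one) (convDensity_nonneg w)

lemma integrable_convMoll_comp (hc : 0 < c) (hW : Measurable W) (h1 : ∀ w, |W w| ≤ 1)
    {X : S2 × S2 → R3} (hX : Measurable X) :
    Integrable (fun q => convMoll W c (X q)) pairMeasure := by
  refine Integrable.of_bound ((measurable_convMoll hW c).comp hX).aestronglyMeasurable _
    (Eventually.of_forall fun q => abs_convMoll_le hc h1 (X q))

lemma integrable_indicator_one (hE : MeasurableSet E) :
    Integrable (E.indicator fun _ => (1 : ℝ)) surfaceMeasure :=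
  (integrable_const 1).indicator hE

/-- If the row integrals of `K` are all equal, the integral over the rows in `E` is proportional to
the measure of `E`. -/
lemma integral_indicator_fst_mul (hE : MeasurableSet E) {K : S2 × S2 → ℝ}
    (hi : Integrable K pairMeasure)
    (hK : ∀ x x', ∫ y, K (x, y) ∂surfaceMeasure = ∫ y, K (x', y) ∂surfaceMeasure) :
    Integrable (fun q => E.indicator (fun _ => (1 : ℝ)) q.1 * K q) pairMeasure ∧
    ∫ q, E.indicator (fun _ => (1 : ℝ)) q.1 * K q ∂pairMeasure =
      surfaceMeasure.real E / (4 * π) * ∫ q, K q ∂pairMeasure := by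
  have hi' : Integrable (fun q => E.indicator (fun _ => (1 : ℝ)) q.1 * K q) pairMeasure := by
    refine hi.bdd_mul (c := 1) ?_ (Eventually.of_forall fun q => ?_)
    · exact ((measurable_const.indicator hE).comp measurable_fst).aestronglyMeasurable
    · by_cases h : q.1 ∈ E <;> simp [h]
  refine ⟨hi', ?_⟩
  have x₀ : S2 := ⟨EuclideanSpace.single 0 1, by simp⟩
  rw [integral_prod _ hi', integral_prod _ hi]
  simp_rw [integral_const_mul, fun x => hK x x₀]
  rw [integral_mul_const, integral_const, surfaceMeasure_real_univ, smul_eq_mul,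
    integral_indicator hE, setIntegral_const, smul_eq_mul]
  field_simp

/-- The mass that a pair of points of `E` carries is small compared with the measure of `E`. -/
lemma integral_indicator_mul_convMoll_le (hc : 0 < c) (hE : MeasurableSet E) {N : ℝ} (hN : 0 ≤ N)
    {X : S2 × S2 → R3} (hX : Measurable X)
    (hXK : ∀ {Φ : R3 → ℝ}, Measurable Φ → (∀ (U : R3 ≃ₗᵢ[ℝ] R3) v, Φ (U v) = Φ v) → ∀ x x',
      ∫ y, Φ (X (x, y)) ∂surfaceMeasure = ∫ y, Φ (X (x', y)) ∂surfaceMeasure)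
    (hXI : ∀ {Φ : R3 → ℝ}, Measurable Φ →
      ∫ q, Φ (X q) ∂pairMeasure = ∫ w, convDensity w * Φ w) :
    ∫ q, (E.indicator (fun _ => (1 : ℝ)) q.1 * E.indicator (fun _ => (1 : ℝ)) q.2) *
        convMoll (fun _ => 1) c (X q) ∂pairMeasure ≤
      surfaceMeasure.real E * (N * surfaceMeasure.real E +
        (∫ v, convDensity v * convMoll (highPart N) c v) / (4 * π)) := by
  have hh : ∀ w, |highPart N w| ≤ 1 := fun w => by
    rw [abs_of_nonneg (highPart_nonneg N w)]; exact highPart_le_one N w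
  have hm := measurable_convMoll (measurable_highPart N) c
  have hinv := convMoll_isometry (W := highPart N) (c := c)
    fun U v => by simp [highPart, convDensity_isometry]
  obtain ⟨i1, e1⟩ := integral_indicator_fst_mul hE
    (integrable_convMoll_comp hc (measurable_highPart N) hh hX) (hXK hm hinv)
  rw [hXI hm] at e1
  have hG := (integrable_indicator_one hE).mul_prod (integrable_indicator_one hE)
  have e2 : ∫ q : S2 × S2, E.indicator (fun _ => (1 : ℝ)) q.1 * E.indicator (fun _ => (1 : ℝ)) q.2
      ∂pairMeasure = surfaceMeasure.real E * surfaceMeasure.real E := by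
    rw [integral_prod_mul, integral_indicator hE, setIntegral_const, smul_eq_mul, mul_one]
  have hle : ∀ q : S2 × S2, (E.indicator (fun _ => (1 : ℝ)) q.1 *
      E.indicator (fun _ => (1 : ℝ)) q.2) * convMoll (fun _ => 1) c (X q) ≤
      N * (E.indicator (fun _ => (1 : ℝ)) q.1 * E.indicator (fun _ => (1 : ℝ)) q.2) +
      E.indicator (fun _ => (1 : ℝ)) q.1 * convMoll (highPart N) c (X q) := by
    intro q
    have h1 := convMoll_le_add hc hN (X q)
    have h2 := convMoll_nonneg (highPart_nonneg N) c (X q)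
    by_cases ha : q.1 ∈ E <;> by_cases hb : q.2 ∈ E <;> simp [ha, hb, h1, h2]
  have hl := integral_mono_of_nonneg (Eventually.of_forall fun q => ?_)
    ((hG.const_mul N).add i1) (Eventually.of_forall hle)
  · refine hl.trans_eq ?_
    rw [integral_add' (hG.const_mul N) i1, integral_const_mul, e2, e1]
    ring
  · have := convMoll_nonneg (W := fun _ => 1) (fun _ => zero_le_one) c (X q)
    by_cases ha : q.1 ∈ E <;> by_cases hb : q.2 ∈ E <;> simp [ha, hb, this]

/-- The sign that is `-1` on `E` and `1` elsewhere. -/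
noncomputable def signOf (E : Set S2) (x : S2) : ℝ := 1 - 2 * E.indicator (fun _ => 1) x

lemma integrable_signOf (hE : MeasurableSet E) : Integrable (signOf E) surfaceMeasure :=
  (integrable_const 1).sub ((integrable_indicator_one hE).const_mul 2)

/-- The quadruples with `x₁ ∈ E` and `x₂, x₃, x₄ ∉ E` all contribute to the loss
incurred by a change of sign on `E`. -/
lemma prodFour_signOf_le (p : (S2 × S2) × (S2 × S2)) :
    prodFour (signOf E) p ≤ 1 - 2 * (E.indicator (fun _ => (1 : ℝ)) p.1.1 -
      E.indicator (fun _ => (1 : ℝ)) p.1.1 * E.indicator (fun _ => (1 : ℝ)) p.1.2 -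
      E.indicator (fun _ => (1 : ℝ)) p.1.1 * E.indicator (fun _ => (1 : ℝ)) p.2.1 -
      E.indicator (fun _ => (1 : ℝ)) p.1.1 * E.indicator (fun _ => (1 : ℝ)) p.2.2) := by
  unfold prodFour signOf
  by_cases h1 : p.1.1 ∈ E <;> by_cases h2 : p.1.2 ∈ E <;> by_cases h3 : p.2.1 ∈ E <;>
    by_cases h4 : p.2.2 ∈ E <;> simp [h1, h2, h3, h4] <;> norm_num

lemma quadForm_signOf_le (hc : 0 < c) (hE : MeasurableSet E) {N : ℝ} (hN : 0 ≤ N) :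
    quadForm c (signOf E) ≤ quadForm c (fun _ => 1) -
      2 * surfaceMeasure.real E * (quadForm c (fun _ => 1) / (4 * π) -
        3 * (N * surfaceMeasure.real E +
          (∫ v, convDensity v * convMoll (highPart N) c v) / (4 * π))) := by
  set e : S2 → ℝ := E.indicator fun _ => 1 with he
  have hW : Measurable fun _ : R3 => (1 : ℝ) := measurable_const
  have hM : ∀ w : R3, ‖w‖ ≤ 2 → |(fun _ : R3 => (1 : ℝ)) w| ≤ 1 := fun w _ => by simp
  have hei : Integrable e surfaceMeasure := integrable_indicator_one hE
  have hG1 : Integrable (fun _ : S2 × S2 => (1 : ℝ)) pairMeasure := integrable_const 1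
  have hGe : Integrable (fun q : S2 × S2 => e q.1) pairMeasure := hei.comp_fst surfaceMeasure
  have hGee : Integrable (fun q : S2 × S2 => e q.1 * e q.2) pairMeasure := hei.mul_prod hei
  have j0 := integrable_addTerm hc hW hM hG1
  have j1 := integrable_addTerm hc hW hM hGe
  have j2 := integrable_addTerm hc hW hM hGee
  have js := integrable_subTerm hc hW hM hGee
  have j3 := measurePreserving_13_24.integrable_comp_of_integrable js
  have j4 := measurePreserving_14_23.integrable_comp_of_integrable js
  have q0 := integral_addTerm hc hW hM hG1
  have q1 := integral_addTerm hc hW hM hGe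
  have q2 := integral_addTerm hc hW hM hGee
  have qs := integral_subTerm hc hW hM (by simp) hGee
  have q3 := integral_comp_of_measurePreserving measurePreserving_13_24 js
  have q4 := integral_comp_of_measurePreserving measurePreserving_14_23 js
  have hone : ∫ p, addTerm (fun _ => 1) (fun _ => 1) c p ∂quadMeasure =
      quadForm c fun _ => 1 := by
    unfold quadForm
    refine integral_congr_ae (Eventually.of_forall fun p => ?_)
    simp [addTerm, prodFour, defect]
  have hinv := convMoll_isometry (W := fun _ => 1) (c := c) fun U v => rfl
  have hr := (integral_indicator_fst_mul hE
    (integrable_convMoll_comp hc hW (by simp) (X := fun q => (q.1 + q.2 : R3)) (by fun_prop))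
    (integral_comp_add_eq (measurable_convMoll hW c) hinv)).2
  have b2 := integral_indicator_mul_convMoll_le hc hE hN (X := fun q => (q.1 + q.2 : R3))
    (by fun_prop) integral_comp_add_eq integral_add_eq_integral_convDensity
  have b3 := integral_indicator_mul_convMoll_le hc hE hN (X := fun q => (q.1 - q.2 : R3))
    (by fun_prop) integral_comp_sub_eq integral_sub_eq_integral_convDensity
  simp only [one_mul] at q0
  rw [q0] at hone
  rw [hone, ← he] at hr
  rw [← he] at b2 b3
  have hle : quadForm c (signOf E) ≤ ∫ p, (addTerm (fun _ => 1) (fun _ => 1) c p -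
      2 * (addTerm (fun _ => 1) (fun q => e q.1) c p -
        addTerm (fun _ => 1) (fun q => e q.1 * e q.2) c p -
        subTerm (fun _ => 1) (fun q => e q.1 * e q.2) c ((p.1.1, p.2.1), (p.1.2, p.2.2)) -
        subTerm (fun _ => 1) (fun q => e q.1 * e q.2) c ((p.1.1, p.2.2), (p.1.2, p.2.1))))
        ∂quadMeasure := by
    refine integral_mono (integrable_mul_heat_defect hc (integrable_prodFour (integrable_signOf hE)))
      (j0.sub ((((j1.sub j2).sub j3).sub j4).const_mul 2)) fun p => ?_
    have e3 : (p.1.1 - p.2.1 + (p.1.2 - p.2.2) : R3) = defect p := by unfold defect; abel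
    have e5 : (p.1.1 - p.2.2 + (p.1.2 - p.2.1) : R3) = defect p := by unfold defect; abel
    have e1 : (p.1.1 + p.1.2 - (p.2.1 + p.2.2) : R3) = defect p := rfl
    have := mul_le_mul_of_nonneg_right (prodFour_signOf_le (E := E) p)
      (heat_nonneg c (defect p))
    simp only [addTerm, subTerm, e1, e3, e5]
    rw [← he] at this
    linarith
  have k1 : Integrable (fun p => addTerm (fun _ => 1) (fun q => e q.1) c p -
        addTerm (fun _ => 1) (fun q => e q.1 * e q.2) c p) quadMeasure := j1.sub j2
  have k2 : Integrable (fun p => addTerm (fun _ => 1) (fun q => e q.1) c p -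
        addTerm (fun _ => 1) (fun q => e q.1 * e q.2) c p -
        subTerm (fun _ => 1) (fun q => e q.1 * e q.2) c ((p.1.1, p.2.1), (p.1.2, p.2.2)))
        quadMeasure := k1.sub j3
  have k3 : Integrable (fun p => addTerm (fun _ => 1) (fun q => e q.1) c p -
        addTerm (fun _ => 1) (fun q => e q.1 * e q.2) c p -
        subTerm (fun _ => 1) (fun q => e q.1 * e q.2) c ((p.1.1, p.2.1), (p.1.2, p.2.2)) -
        subTerm (fun _ => 1) (fun q => e q.1 * e q.2) c ((p.1.1, p.2.2), (p.1.2, p.2.1)))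
        quadMeasure := k2.sub j4
  simp only [Function.comp_def] at j3 j4
  rw [integral_sub j0 (k3.const_mul 2), integral_const_mul, integral_sub k2 j4,
    integral_sub k1 j3, integral_sub j1 j2, q3, q4, qs, q2, q1, q0, hone, hr] at hle
  linear_combination hle + 2 * b2 + 4 * b3

/-- A sign changing on a set of small positive measure is not a maximizer. -/
lemma exists_pos_of_tendsto_quadForm_signOf :
    ∃ ε : ℝ, 0 < ε ∧ ∀ E : Set S2, MeasurableSet E → surfaceMeasure.real E < ε →
      Tendsto (fun n : ℕ => quadForm (n + 1) (signOf E)) atTop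
        (𝓝 (π / 4 * energy fun _ => 1)) → surfaceMeasure.real E = 0 := by
  set T := π / 4 * energy fun _ => 1 with hT
  have hTpos : 0 < T := by have := energy_one_pos; positivity
  set b := ∫ w, convDensity w ^ 2
  have hb : 0 ≤ b := integral_nonneg fun w => sq_nonneg _
  -- `t` and then `N` make the mass of the high part at most `T / 12`
  set t := 12 * (b + 1) / T with ht
  have htpos : 0 < t := by positivity
  have htb : t⁻¹ * b ≤ T / 12 := by
    rw [ht, inv_div, div_mul_eq_mul_div, div_le_div_iff₀ (by positivity) (by norm_num)]
    nlinarith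
  obtain ⟨N, hN⟩ := ((tendsto_integral_highPart.const_mul t).eventually_lt_const
    (show t * 0 < T / 12 by rw [mul_zero]; positivity)).exists
  have hJ : ∀ n : ℕ, ∫ v, convDensity v * convMoll (highPart N) (n + 1) v ≤ T / 12 := fun n => by
    have := integral_heat_mul_convDensity_le (c := n + 1) (N := N) (by positivity) htpos
    linarith
  refine ⟨T / (16 * π * 3 * (N + 1)), by positivity, fun E hE hsmall hlim => ?_⟩
  set m := surfaceMeasure.real E
  have hm : 0 ≤ m := measureReal_nonneg
  have h1 := tendsto_quadForm_one.comp tendsto_natCast_add_one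
  have h2 : ∀ n : ℕ, quadForm (n + 1) (signOf E) ≤ quadForm (n + 1) (fun _ => 1) -
      2 * m * (quadForm (n + 1) (fun _ => 1) / (4 * π) - 3 * (N * m + T / 12 / (4 * π))) := by
    intro n
    refine (quadForm_signOf_le (c := n + 1) (by positivity) hE (N := N) (by positivity)).trans ?_
    gcongr
    exact hJ n
  have h3 := le_of_tendsto_of_tendsto' hlim
    (h1.sub (((h1.div_const (4 * π)).sub_const (3 * (N * m + T / 12 / (4 * π)))).const_mul (2 * m)))
    h2
  rw [lt_div_iff₀ (by positivity)] at hsmall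
  have h4 : 0 < T / (4 * π) - 3 * (N * m + T / 12 / (4 * π)) := by
    have : T / (4 * π) - 3 * (N * m + T / 12 / (4 * π)) =
        (3 * T - 16 * π * 3 * (N * m)) / (16 * π) := by field_simp; ring
    rw [this]
    refine div_pos ?_ (by positivity)
    have : 0 ≤ m * (16 * π * 3) := by positivity
    nlinarith
  by_contra hne
  have := mul_pos (show 0 < 2 * m by positivity) h4
  linarith

end parity

/-! ### The sharp inequality and its cases of equality -/

section final

variable {f : S2 → ℂ}

lemma eLpNorm_two_pow_four (hf : MemLp f 2 surfaceMeasure) :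
    eLpNorm f 2 surfaceMeasure ^ 4 =
      ENNReal.ofReal ((∫ x, ‖f x‖ ^ 2 ∂surfaceMeasure) ^ 2) := by
  have h : eLpNorm f 2 surfaceMeasure ^ 2 = ENNReal.ofReal (∫ x, ‖f x‖ ^ 2 ∂surfaceMeasure) := by
    have := eLpNorm_nnreal_pow_eq_lintegral (f := f) (μ := surfaceMeasure) (p := 2) (by norm_num)
    simp only [NNReal.coe_ofNat, ENNReal.coe_ofNat, ENNReal.rpow_ofNat] at this
    rw [this, ofReal_integral_eq_lintegral_ofReal hf.norm.integrable_sq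
      (Eventually.of_forall fun x => sq_nonneg _)]
    refine lintegral_congr fun x => ?_
    rw [ENNReal.ofReal_pow (norm_nonneg _), ofReal_norm]
  rw [ENNReal.ofReal_pow (integral_nonneg fun x => sq_nonneg _), ← h, ← pow_mul]

lemma restrictionRatio_one : restrictionRatio (fun _ => 1) =
    ENNReal.ofReal (2 * π ^ 4 * (energy fun _ => 1) / (4 * π) ^ 2) := by
  unfold restrictionRatio
  rw [eLpNorm_fourierSphere_one, eLpNorm_two_pow_four (memLp_const 1)]
  simp only [norm_one, one_pow, integral_const, surfaceMeasure_real_univ, smul_eq_mul, mul_one]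
  rw [ENNReal.ofReal_div_of_pos (by positivity)]

lemma fourierSphere_congr {g : S2 → ℂ} (h : f =ᵐ[surfaceMeasure] g) :
    fourierSphere f = fourierSphere g := by
  ext ξ
  unfold fourierSphere
  refine integral_congr_ae ?_
  filter_upwards [h] with x hx
  rw [hx]

/-- Near the constant `1`, a real function of constant modulus with an extremal transform has
constant sign. -/
lemma exists_pos_forall_ae_eq_of_sq_eq :
    ∃ δ : ℝ, 0 < δ ∧ ∀ f : S2 → ℂ, MemLp f 2 surfaceMeasure →
      eLpNorm (fun x => f x - 1) 2 surfaceMeasure < ENNReal.ofReal δ → ∀ m : ℝ, 0 < m →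
      (∀ᵐ x ∂surfaceMeasure, ‖f x‖ ^ 2 = m) → (∀ᵐ x ∂surfaceMeasure, (f x).im = 0) →
      eLpNorm (fourierSphere f) 4 (volume : Measure R3) ^ 4 =
        ENNReal.ofReal (2 * π ^ 4 * (m ^ 2 * energy fun _ => 1)) →
      ∃ c : ℂ, ∀ᵐ x ∂surfaceMeasure, f x = c := by
  obtain ⟨ε, hε, hE⟩ := exists_pos_of_tendsto_quadForm_signOf
  refine ⟨√ε, by positivity, fun f hf hδ m hm hnorm him hQ => ?_⟩
  set r := √m with hr
  have hrpos : 0 < r := by positivity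
  have hr2 : r ^ 2 = m := sq_sqrt hm.le
  -- a measurable set on which `f` is negative
  set u := hf.aestronglyMeasurable.mk f with hu
  have hum : Measurable u := hf.aestronglyMeasurable.stronglyMeasurable_mk.measurable
  have hfu : f =ᵐ[surfaceMeasure] u := hf.aestronglyMeasurable.ae_eq_mk
  set E : Set S2 := {x | (u x).re < 0} with hEdef
  have hEm : MeasurableSet E :=
    measurableSet_lt (Complex.measurable_re.comp hum) measurable_const
  have hfs : f =ᵐ[surfaceMeasure] fun x => ((r * signOf E x : ℝ) : ℂ) := by
    filter_upwards [hfu, hnorm, him] with x h1 h2 h3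
    have h4 : f x = ((f x).re : ℂ) := Complex.ext (by simp) (by simp [h3])
    rw [h4, Complex.norm_real, Real.norm_eq_abs, sq_abs, ← hr2] at h2
    rw [h4]
    congr 1
    unfold signOf
    by_cases hx : x ∈ E
    · have hneg : (f x).re < 0 := by rw [h1]; exact hx
      rw [indicator_of_mem hx]
      rcases sq_eq_sq_iff_eq_or_eq_neg.1 h2 with h | h <;> linarith
    · have hneg : 0 ≤ (f x).re := by rw [h1]; exact not_lt.1 hx
      rw [indicator_of_notMem hx]
      rcases sq_eq_sq_iff_eq_or_eq_neg.1 h2 with h | h <;> linarith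
  -- `|f - 1| ≥ 1` on `E`
  have hsmall : surfaceMeasure.real E < ε := by
    have h1 : surfaceMeasure E ≤ eLpNorm (fun x => f x - 1) 2 surfaceMeasure ^ 2 := by
      have := eLpNorm_nnreal_pow_eq_lintegral (f := fun x => f x - 1) (μ := surfaceMeasure) (p := 2)
        (by norm_num)
      simp only [NNReal.coe_ofNat, ENNReal.coe_ofNat, ENNReal.rpow_ofNat] at this
      rw [this, ← lintegral_indicator_one hEm]
      refine lintegral_mono_ae ?_
      filter_upwards [hfs] with x hx
      by_cases hxE : x ∈ E
      · rw [indicator_of_mem hxE, hx, ← ofReal_norm, ← Complex.ofReal_one, ← Complex.ofReal_sub,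
          Complex.norm_real, ← ENNReal.ofReal_pow (norm_nonneg _), Pi.one_apply, ← ENNReal.ofReal_one]
        refine ENNReal.ofReal_le_ofReal ?_
        rw [Real.norm_eq_abs, sq_abs, signOf, indicator_of_mem hxE]
        nlinarith
      · rw [indicator_of_notMem hxE]; exact zero_le
    have h2 : surfaceMeasure E < ENNReal.ofReal ε := by
      refine h1.trans_lt ?_
      rw [← sq_sqrt hε.le, ENNReal.ofReal_pow (by positivity)]
      exact ENNReal.pow_lt_pow_left (by norm_num) hδ
    exact (ENNReal.lt_ofReal_iff_toReal_lt h2.ne_top).1 h2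
  have hlim : Tendsto (fun n : ℕ => quadForm (n + 1) (signOf E)) atTop
      (𝓝 (π / 4 * energy fun _ => 1)) := by
    have hs := (integrable_signOf hEm).const_mul r
    have h1 := tendsto_fourthPower hs.ofReal
    have h2 : fourierSphere f = fourierSphere fun x => ((r * signOf E x : ℝ) : ℂ) :=
      fourierSphere_congr hfs
    simp only [Complex.coe_algebraMap] at h1
    rw [← h2, hQ] at h1
    have h3 := (ENNReal.tendsto_toReal ENNReal.ofReal_ne_top).comp h1
    rw [ENNReal.toReal_ofReal (by have := energy_one_pos; positivity)] at h3
    have h4 := h3.const_mul (((2 * π) ^ 3 * r ^ 4)⁻¹)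
    have h5 : ((2 * π) ^ 3 * r ^ 4)⁻¹ * (2 * π ^ 4 * (m ^ 2 * energy fun _ => 1)) =
        π / 4 * energy fun _ => 1 := by
      rw [← hr2]; field_simp; ring
    rw [h5] at h4
    refine h4.congr fun n => ?_
    have h6 : 0 ≤ fourthPower (n + 1) fun x => ((r * signOf E x : ℝ) : ℂ) :=
      integral_nonneg fun ξ => mul_nonneg (by positivity) (heatMultiplier_pos _ ξ).le
    simp only [Function.comp_apply]
    rw [ENNReal.toReal_ofReal h6, fourthPower_ofReal hs (by positivity)]
    have h7 : quadForm (n + 1) (fun x => r * signOf E x) = r ^ 4 * quadForm (n + 1) (signOf E) := by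
      unfold quadForm prodFour
      rw [← integral_const_mul]
      congr 1
      ext p
      ring
    rw [h7]
    field_simp
  have hnull := hE E hEm hsmall hlim
  rw [measureReal_eq_zero_iff] at hnull
  refine ⟨(r : ℂ), ?_⟩
  filter_upwards [hfs, measure_eq_zero_iff_ae_notMem.1 hnull] with x hx hxE
  rw [hx, signOf, indicator_of_notMem hxE]
  simp

/-- The sharp bound and its case of equality; no smallness is needed here. -/
lemma restrictionRatio_le (hf : MemLp f 2 surfaceMeasure)
    (hpos : 0 < ∫ x, ‖f x‖ ^ 2 ∂surfaceMeasure) :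
    restrictionRatio f ≤ restrictionRatio (fun _ => 1) ∧
      (restrictionRatio f = restrictionRatio (fun _ => 1) →
        (∀ᵐ x ∂surfaceMeasure, ‖f x‖ ^ 2 = (4 * π)⁻¹ * ∫ x, ‖f x‖ ^ 2 ∂surfaceMeasure) ∧
        eLpNorm (fourierSphere f) 4 (volume : Measure R3) ^ 4 = ENNReal.ofReal (2 * π ^ 4 *
          (((4 * π)⁻¹ * ∫ x, ‖f x‖ ^ 2 ∂surfaceMeasure) ^ 2 * energy fun _ => 1))) := by
  set I := ∫ x, ‖f x‖ ^ 2 ∂surfaceMeasure with hI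
  obtain ⟨h1, h2⟩ := energy_le hf.norm.integrable_sq
  simp only [← hI] at h1 h2
  have h3 := eLpNorm_fourierSphere_le hf
  have hE := energy_one_pos
  have hmul : restrictionRatio (fun _ => 1) * ENNReal.ofReal (I ^ 2) =
      ENNReal.ofReal (2 * π ^ 4 * (((4 * π)⁻¹ * I) ^ 2 * energy fun _ => 1)) := by
    rw [restrictionRatio_one, ← ENNReal.ofReal_mul (by positivity)]
    congr 1
    field_simp
  have hI0 : ENNReal.ofReal (I ^ 2) ≠ 0 := by
    rw [Ne, ENNReal.ofReal_eq_zero, not_le]; positivity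
  have hdef : restrictionRatio f = eLpNorm (fourierSphere f) 4 (volume : Measure R3) ^ 4 /
      ENNReal.ofReal (I ^ 2) := by
    unfold restrictionRatio
    rw [eLpNorm_two_pow_four hf]
  refine ⟨?_, fun heq => ?_⟩
  · rw [hdef, ENNReal.div_le_iff hI0 ENNReal.ofReal_ne_top, hmul]
    refine h3.trans (ENNReal.ofReal_le_ofReal ?_)
    exact mul_le_mul_of_nonneg_left h1 (by positivity)
  · replace heq : eLpNorm (fourierSphere f) 4 (volume : Measure R3) ^ 4 =
        ENNReal.ofReal (2 * π ^ 4 * (((4 * π)⁻¹ * I) ^ 2 * energy fun _ => 1)) := by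
      rw [← hmul, ← heq, hdef, ENNReal.div_mul_cancel hI0 ENNReal.ofReal_ne_top]
    refine ⟨h2 (le_antisymm h1 ?_), heq⟩
    rw [heq] at h3
    have h4 : 0 < 2 * π ^ 4 * (((4 * π)⁻¹ * I) ^ 2 * energy fun _ => 1) := by positivity
    exact le_of_mul_le_mul_left ((ENNReal.ofReal_le_ofReal_iff' .. |>.1 h3).resolve_right
      (not_le.2 h4)) (by positivity)

end final

theorem theorem1p5 :
    ∃ δ : ℝ, 0 < δ ∧
      ∀ f : S2 → ℂ, MemLp f 2 surfaceMeasure →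
        eLpNorm (fun x => f x - 1) 2 surfaceMeasure < ENNReal.ofReal δ →
        restrictionRatio f ≤ restrictionRatio (fun _ => 1) ∧
        (restrictionRatio f = restrictionRatio (fun _ => 1) →
          (∃ r : ℝ, ∀ᵐ x ∂surfaceMeasure, ‖f x‖ = r) ∧
          ((∀ᵐ x ∂surfaceMeasure, (f x).im = 0) →
            ∃ c : ℂ, ∀ᵐ x ∂surfaceMeasure, f x = c)) := by
  obtain ⟨δ, hδ, hreal⟩ := exists_pos_forall_ae_eq_of_sq_eq
  refine ⟨δ, hδ, fun f hf hfδ => ?_⟩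
  have hnn : 0 ≤ ∫ x, ‖f x‖ ^ 2 ∂surfaceMeasure := integral_nonneg fun x => sq_nonneg _
  rcases hnn.eq_or_lt with h0 | hpos
  · -- for `f = 0` almost everywhere the ratio is `0 / 0 = 0`
    have hz : ∀ᵐ x ∂surfaceMeasure, f x = 0 := by
      have := (integral_eq_zero_iff_of_nonneg (fun x => sq_nonneg ‖f x‖)
        hf.norm.integrable_sq).1 h0.symm
      filter_upwards [this] with x hx
      simpa using hx
    have hF : fourierSphere f = fun _ => 0 := by
      rw [fourierSphere_congr (g := fun _ => 0) hz]
      ext ξ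
      simp [fourierSphere]
    refine ⟨?_, fun _ => ⟨⟨0, ?_⟩, fun _ => ⟨0, hz⟩⟩⟩
    · simp [restrictionRatio, hF]
    · filter_upwards [hz] with x hx
      simp [hx]
  · obtain ⟨h1, h2⟩ := restrictionRatio_le hf hpos
    refine ⟨h1, fun heq => ?_⟩
    obtain ⟨h3, h4⟩ := h2 heq
    refine ⟨⟨√((4 * π)⁻¹ * ∫ x, ‖f x‖ ^ 2 ∂surfaceMeasure), ?_⟩, fun him => ?_⟩
    · filter_upwards [h3] with x hx
      rw [← hx, sqrt_sq (norm_nonneg _)]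
    · exact hreal f hf hfδ _ (by positivity) h3 him h4
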